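/- Let $N,X_1,X_2,\dots$ be independent random variables, where $N$ takes values in $\{0,1,2,\dots\}$ and $X_1,X_2,\dots$ are real-valued, identically distributed and satisfy $E|X_1|^3<\infty$. Put $$a:=E[X_1],\quad b^2:=E[X_1^2],\quad c^2:=\operatorname{Var}(X_1),\quad d^3:=E|X_1-E[X_1]|^3 ,\qquad b,c,d\ge 0.$$ Assume that for some integer $n\ge 1$ the index $N$ has the same distribution as $N_1+\dots+N_n$, where $N_1,\dots,N_n$ are i.i.d. nonnegative real random variables with $E[N_1^3]<\infty$, and put $$\alpha_1:=E[N_1],\quad \beta_1^2:=E[N_1^2],\quad \gamma_1^2:=\operatorname{Var}(N_1),\quad \delta_1^3:=E[N_1^3],\quad \sigma_1:=\sqrt{c^2\alpha_1+a^2\gamma_1^2}.$$ Let $S:=\sum_{j=1}^N X_j$, assume $\operatorname{Var}(S)>0$, and let $$W:=\frac{S-E[S]}{\sqrt{\operatorname{Var}(S)}} .$$ Let $Z$ be standard normal, and for real random variables $U,V$ with finite first absolute moments let $d_{\mathcal W}(U,V):=\sup_h|E[h(U)]-E[h(V)]|$, where the supremum is over all Lipschitz functions $h:\mathbb R\to\mathbb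 R$ with Lipschitz constant at most $1$. Then $$d_{\mathcal W}(W,Z)\le\frac1{\sqrt n}\left(\frac{2c^2b\gamma_1^2}{\sigma_1^3}+\frac{3\alpha_1d^3}{\sigma_1^3}+\sqrt{\frac2\pi}\,\frac{\alpha_1a^2\gamma_1^2}{\sigma_1^2}+\frac{2\alpha_1(a^2b+|a|b^2)}{\sigma_1^3}\Bigl(\frac{\delta_1^3}{\alpha_1}-\beta_1^2\Bigr)\right).$$ -/

import Mathlib

open MeasureTheory ProbabilityTheory
open scoped ENNReal

/-- The Wasserstein distance of two probability measures on the real line: the supremum of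
`|∫ h dμ - ∫ h dν|` over all functions `h : ℝ → ℝ` with Lipschitz constant at most `1`.
It is meant for measures with finite first absolute moment, so that all such `h` are
integrable. The supremum is taken in `[0, ∞]`. -/
noncomputable def wassersteinDist (μ ν : Measure ℝ) : ℝ≥0∞ :=
  ⨆ (h : ℝ → ℝ) (_ : LipschitzWith 1 h), ENNReal.ofReal |∫ x, h x ∂μ - ∫ x, h x ∂ν|

/-- The random sum `S = X₁ + ⋯ + X_N`; the summand `X_j` is `X (j - 1)`, and `S = 0` where
`N = 0`. -/
def randomSum {Ω : Type*} (N : Ω → ℕ) (X : ℕ → Ω → ℝ) (ω : Ω) : ℝ :=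
  ∑ j ∈ Finset.range (N ω), X j ω

/-- The normalized version `(Y - E[Y]) / √Var(Y)` of a random variable `Y`. -/
noncomputable def normalized {Ω : Type*} [MeasurableSpace Ω] (P : Measure Ω) (Y : Ω → ℝ)
    (ω : Ω) : ℝ :=
  (Y ω - ∫ ω', Y ω' ∂P) / √(Var[Y; P])

open Filter Topology Set

/-! ### Integrals against the standard normal density -/

/-! The proof is Stein's method. For 1-Lipschitz `h`, Stein's equation f'(x) - x f(x) = h(x) - E
h(Z) has a bounded solution whose derivative is bounded and 2-Lipschitz (`exists_stein_solution`).
Hence `wassersteinDist_normalized_le` reduces the claim to bounding E[(S - ES) F(S)] - Var(S)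
E[F'(S)] for test functions F whose derivative has Lipschitz constant L = 2 / Var(S).

Given N = k, write S_k for the sum of the first k summands and split S_k - ES = (S_k - ka) + a(k -
EN), which mirrors Var(S) = c² EN + a² Var(N). In the first part every summand is independent of the
others, so a Taylor expansion yields k c² E F'(S_k) up to k (3L/2) d³
(`abs_integral_partialSum_mul_comp_le`). Replacing the random factor N by EN then costs the
covariance of N with a Lipschitz function of N, at most L b Var(N). For the second part put g(k) = E
F(S_k) and g₁(k) = E F'(S_k). Since a g₁ acts as a derivative of g, what is needed is an approximate
Stein identity for the index alone: E[(N - EN) g(N)] ≈ a Var(N) E g₁(N). `abs_integral_randomSum_le`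
combines the parts.

The identity for the index uses that N is distributed as a sum of n i.i.d. nonnegative variables.
Conditioning on all but one of them leaves a covariance in a single variable M, which
`abs_integral_sub_mean_mul_le` treats by symmetrising over two independent copies; the error is a
multiple of Cov(M, M²) = δ₁³ - α₁ β₁².

Each error is of order nL, hence bounded in n because Var(S) = n σ₁²; division by the standard
deviation √n σ₁ produces the rate. The term with √(2/π) does not arise in this argument and is only
slack. -/

lemma hasDerivAt_gaussianPDFReal_std (x : ℝ) :
    HasDerivAt (gaussianPDFReal 0 1) (-x * gaussianPDFReal 0 1 x) x := by
  have h : HasDerivAt (fun y : ℝ => (√(2 * Real.pi * ((1 : NNReal) : ℝ)))⁻¹ *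
      Real.exp (-(y - 0) ^ 2 / (2 * ((1 : NNReal) : ℝ))))
      ((√(2 * Real.pi * ((1 : NNReal) : ℝ)))⁻¹ *
        (Real.exp (-(x - 0) ^ 2 / (2 * ((1 : NNReal) : ℝ))) * (-x))) x := by
    refine HasDerivAt.const_mul _ (HasDerivAt.exp ?_)
    have := ((((hasDerivAt_id x).sub_const 0).pow 2).neg).div_const (2 * ((1 : NNReal) : ℝ))
    refine this.congr_deriv ?_
    simp only [id, NNReal.coe_one, sub_zero]
    norm_num
    ring
  have e : gaussianPDFReal 0 1 = fun y : ℝ => (√(2 * Real.pi * ((1 : NNReal) : ℝ)))⁻¹ *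
      Real.exp (-(y - 0) ^ 2 / (2 * ((1 : NNReal) : ℝ))) := rfl
  rw [e]
  convert h using 1
  ring

lemma integrable_gaussianReal_iff {g : ℝ → ℝ} :
    Integrable g (gaussianReal 0 1) ↔ Integrable (fun x => g x * gaussianPDFReal 0 1 x) := by
  rw [gaussianReal_of_var_ne_zero _ one_ne_zero]
  rw [integrable_withDensity_iff_integrable_smul₀' (measurable_gaussianPDF 0 1).aemeasurable
    (ae_of_all _ fun x => gaussianPDF_lt_top)]
  simp [toReal_gaussianPDF, mul_comm]

lemma integral_gaussianReal_std (g : ℝ → ℝ) :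
    ∫ x, g x ∂(gaussianReal 0 1) = ∫ x, g x * gaussianPDFReal 0 1 x := by
  rw [integral_gaussianReal_eq_integral_smul one_ne_zero]
  simp [mul_comm]

lemma integrable_id_gaussian : Integrable (fun x : ℝ => x * gaussianPDFReal 0 1 x) :=
  integrable_gaussianReal_iff.1 ((memLp_id_gaussianReal 1).integrable le_rfl)

lemma integrable_sq_gaussian : Integrable (fun x : ℝ => x ^ 2 * gaussianPDFReal 0 1 x) :=
  integrable_gaussianReal_iff.1 (memLp_id_gaussianReal (μ := 0) (v := 1) 2).integrable_sq

lemma tendsto_zero_of_integrable_deriv_atTop {u u' : ℝ → ℝ} (hu : ∀ x, HasDerivAt u (u' x) x)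
    (hi : Integrable u) (hi' : Integrable u') : Tendsto u atTop (𝓝 0) :=
  tendsto_zero_of_hasDerivAt_of_integrableOn_Ioi (a := 0) (fun x _ => hu x) hi'.integrableOn
    hi.integrableOn

lemma tendsto_zero_of_integrable_deriv_atBot {u u' : ℝ → ℝ} (hu : ∀ x, HasDerivAt u (u' x) x)
    (hi : Integrable u) (hi' : Integrable u') : Tendsto u atBot (𝓝 0) :=
  tendsto_zero_of_hasDerivAt_of_integrableOn_Iic (a := 0) (fun x _ => hu x) hi'.integrableOn
    hi.integrableOn

lemma setIntegral_Ioi_deriv {u u' : ℝ → ℝ} (hu : ∀ x, HasDerivAt u (u' x) x)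
    (hi : Integrable u) (hi' : Integrable u') (x : ℝ) : ∫ t in Ioi x, u' t = - u x := by
  rw [integral_Ioi_of_hasDerivAt_of_tendsto' (fun t _ => hu t) hi'.integrableOn
    (tendsto_zero_of_integrable_deriv_atTop hu hi hi')]
  ring

lemma setIntegral_Iic_deriv {u u' : ℝ → ℝ} (hu : ∀ x, HasDerivAt u (u' x) x)
    (hi : Integrable u) (hi' : Integrable u') (x : ℝ) : ∫ t in Iic x, u' t = u x := by
  rw [integral_Iic_of_hasDerivAt_of_tendsto' (fun t _ => hu t) hi'.integrableOn
    (tendsto_zero_of_integrable_deriv_atBot hu hi hi')]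
  ring

lemma integrable_neg_id_gaussian : Integrable (fun x : ℝ => -x * gaussianPDFReal 0 1 x) := by
  simpa using integrable_id_gaussian.neg

lemma hasDerivAt_id_mul_gaussian (x : ℝ) : HasDerivAt (fun t => t * gaussianPDFReal 0 1 t)
    (gaussianPDFReal 0 1 x - x ^ 2 * gaussianPDFReal 0 1 x) x := by
  refine ((hasDerivAt_id' x).mul (hasDerivAt_gaussianPDFReal_std x)).congr_deriv ?_
  ring

lemma setIntegral_Ioi_id_gaussian (x : ℝ) :
    ∫ t in Ioi x, t * gaussianPDFReal 0 1 t = gaussianPDFReal 0 1 x := by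
  have := setIntegral_Ioi_deriv hasDerivAt_gaussianPDFReal_std (integrable_gaussianPDFReal 0 1)
    integrable_neg_id_gaussian x
  simp only [neg_mul, integral_neg] at this
  linarith

lemma setIntegral_Iic_id_gaussian (x : ℝ) :
    ∫ t in Iic x, t * gaussianPDFReal 0 1 t = - gaussianPDFReal 0 1 x := by
  have := setIntegral_Iic_deriv hasDerivAt_gaussianPDFReal_std (integrable_gaussianPDFReal 0 1)
    integrable_neg_id_gaussian x
  simp only [neg_mul, integral_neg] at this
  linarith

lemma setIntegral_Ioi_sq_gaussian (x : ℝ) :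
    ∫ t in Ioi x, t ^ 2 * gaussianPDFReal 0 1 t =
      x * gaussianPDFReal 0 1 x + ∫ t in Ioi x, gaussianPDFReal 0 1 t := by
  have := setIntegral_Ioi_deriv hasDerivAt_id_mul_gaussian integrable_id_gaussian
    ((integrable_gaussianPDFReal 0 1).sub integrable_sq_gaussian) x
  rw [integral_sub (integrable_gaussianPDFReal 0 1).integrableOn
    integrable_sq_gaussian.integrableOn] at this
  linarith

lemma setIntegral_Iic_sq_gaussian (x : ℝ) :
    ∫ t in Iic x, t ^ 2 * gaussianPDFReal 0 1 t =
      - (x * gaussianPDFReal 0 1 x) + ∫ t in Iic x, gaussianPDFReal 0 1 t := by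
  have := setIntegral_Iic_deriv hasDerivAt_id_mul_gaussian integrable_id_gaussian
    ((integrable_gaussianPDFReal 0 1).sub integrable_sq_gaussian) x
  rw [integral_sub (integrable_gaussianPDFReal 0 1).integrableOn
    integrable_sq_gaussian.integrableOn] at this
  linarith

lemma setIntegral_sub_sq_gaussian (x : ℝ) (s : Set ℝ) :
    ∫ t in s, (t - x) ^ 2 * gaussianPDFReal 0 1 t =
      (∫ t in s, t ^ 2 * gaussianPDFReal 0 1 t) - 2 * x * (∫ t in s, t * gaussianPDFReal 0 1 t)
        + x ^ 2 * ∫ t in s, gaussianPDFReal 0 1 t := by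
  have e : (fun t => (t - x) ^ 2 * gaussianPDFReal 0 1 t) = fun t =>
      t ^ 2 * gaussianPDFReal 0 1 t - 2 * x * (t * gaussianPDFReal 0 1 t)
        + x ^ 2 * gaussianPDFReal 0 1 t := by ext t; ring
  have i1 := integrable_sq_gaussian.integrableOn (s := s)
  have i2 := (integrable_id_gaussian.const_mul (2 * x)).integrableOn (s := s)
  have i3 := ((integrable_gaussianPDFReal 0 1).const_mul (x ^ 2)).integrableOn (s := s)
  rw [e, integral_add (by exact i1.sub i2) i3, integral_sub i1 i2, integral_const_mul,
    integral_const_mul]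

lemma setIntegral_sub_gaussian (x : ℝ) (s : Set ℝ) :
    ∫ t in s, (t - x) * gaussianPDFReal 0 1 t =
      (∫ t in s, t * gaussianPDFReal 0 1 t) - x * ∫ t in s, gaussianPDFReal 0 1 t := by
  have i2 := integrable_id_gaussian.integrableOn (s := s)
  have i3 := ((integrable_gaussianPDFReal 0 1).const_mul x).integrableOn (s := s)
  simp_rw [sub_mul]
  rw [integral_sub i2 i3, integral_const_mul]

/-- Mills' ratio inequality for the upper tail. -/
lemma mills_Ioi (x : ℝ) :
    0 ≤ (1 + x ^ 2) * (∫ t in Ioi x, gaussianPDFReal 0 1 t) - x * gaussianPDFReal 0 1 x := by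
  have h : 0 ≤ ∫ t in Ioi x, (t - x) ^ 2 * gaussianPDFReal 0 1 t :=
    integral_nonneg fun t => mul_nonneg (sq_nonneg _) (gaussianPDFReal_nonneg 0 1 t)
  rw [setIntegral_sub_sq_gaussian, setIntegral_Ioi_id_gaussian, setIntegral_Ioi_sq_gaussian] at h
  linarith

/-- Mills' ratio inequality for the lower tail. -/
lemma mills_Iic (x : ℝ) :
    0 ≤ (1 + x ^ 2) * (∫ t in Iic x, gaussianPDFReal 0 1 t) + x * gaussianPDFReal 0 1 x := by
  have h : 0 ≤ ∫ t in Iic x, (t - x) ^ 2 * gaussianPDFReal 0 1 t :=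
    integral_nonneg fun t => mul_nonneg (sq_nonneg _) (gaussianPDFReal_nonneg 0 1 t)
  rw [setIntegral_sub_sq_gaussian, setIntegral_Iic_id_gaussian, setIntegral_Iic_sq_gaussian] at h
  linarith

lemma integrable_sub_gaussian (x : ℝ) : Integrable (fun t => (t - x) * gaussianPDFReal 0 1 t) := by
  simp_rw [sub_mul]
  exact integrable_id_gaussian.sub ((integrable_gaussianPDFReal 0 1).const_mul x)

lemma integrable_lipschitz_sub_gaussian {h : ℝ → ℝ} (hh : LipschitzWith 1 h) (x : ℝ) :
    Integrable (fun t => (h t - h x) * gaussianPDFReal 0 1 t) := by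
  refine (integrable_sub_gaussian x).mono ?_ (ae_of_all _ fun t => ?_)
  · exact ((hh.continuous.measurable.sub_const _).mul
      (measurable_gaussianPDFReal 0 1)).aestronglyMeasurable
  · rw [norm_mul, norm_mul]
    gcongr
    simpa [dist_eq_norm] using hh.dist_le_mul t x

lemma integrable_lipschitz_gaussian {h : ℝ → ℝ} (hh : LipschitzWith 1 h) :
    Integrable (fun t => h t * gaussianPDFReal 0 1 t) := by
  refine ((integrable_lipschitz_sub_gaussian hh 0).add
    ((integrable_gaussianPDFReal 0 1).const_mul (h 0))).congr (ae_of_all _ fun t => ?_)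
  simp only [Pi.add_apply]; ring

/-! ### The solution of Stein's equation -/

/-- The bounded solution of Stein's equation `f' x - x * f x = h x - E[h(Z)]`. -/
noncomputable def steinSol (h : ℝ → ℝ) (x : ℝ) : ℝ :=
  (∫ t in Iic x, (h t - ∫ y, h y ∂(gaussianReal 0 1)) * gaussianPDFReal 0 1 t) /
    gaussianPDFReal 0 1 x

/-- The derivative of `steinSol h`. -/
noncomputable def steinSolDeriv (h : ℝ → ℝ) (x : ℝ) : ℝ :=
  x * steinSol h x + (h x - ∫ y, h y ∂(gaussianReal 0 1))

lemma hasDerivAt_setIntegral_Iic {u : ℝ → ℝ} (hu : Continuous u) (hi : Integrable u) (x : ℝ) :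
    HasDerivAt (fun x => ∫ t in Iic x, u t) (u x) x := by
  have e : (fun x => ∫ t in Iic x, u t) = fun x => (∫ t in Iic 0, u t) + ∫ t in (0 : ℝ)..x, u t := by
    ext x
    rw [← intervalIntegral.integral_Iic_sub_Iic hi.integrableOn hi.integrableOn]
    ring
  rw [e]
  exact (intervalIntegral.integral_hasDerivAt_right (hu.intervalIntegrable _ _)
    (hu.stronglyMeasurableAtFilter _ _) hu.continuousAt).const_add _

/-- Quotient rule: since φ' = -xφ for the normal density φ, differentiating the denominator produces
the term x f. With `steinSolDeriv` in this form, Stein's equation holds by definition. -/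
lemma hasDerivAt_steinSol {h : ℝ → ℝ} (hh : LipschitzWith 1 h) (x : ℝ) :
    HasDerivAt (steinSol h) (steinSolDeriv h x) x := by
  have hc : Continuous (gaussianPDFReal 0 1) :=
    continuous_iff_continuousAt.2 fun x => (hasDerivAt_gaussianPDFReal_std x).continuousAt
  set m := ∫ y, h y ∂(gaussianReal 0 1) with hm
  have hi : Integrable (fun t => (h t - m) * gaussianPDFReal 0 1 t) := by
    simp_rw [sub_mul]
    exact (integrable_lipschitz_gaussian hh).sub ((integrable_gaussianPDFReal 0 1).const_mul _)
  have hp := (gaussianPDFReal_pos 0 1 x one_ne_zero).ne'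
  have hcont : Continuous (fun t => (h t - m) * gaussianPDFReal 0 1 t) :=
    (hh.continuous.sub continuous_const).mul hc
  have := (hasDerivAt_setIntegral_Iic hcont hi x).div (hasDerivAt_gaussianPDFReal_std x) hp
  refine this.congr_deriv ?_
  simp only [steinSolDeriv, steinSol, ← hm]
  field_simp
  ring

/-- The right-hand sides are the integrals of |t - x| against the normal density over the two
half-lines, and |h(t) - h(x)| ≤ |t - x|. -/
lemma abs_setIntegral_lipschitz_le {h : ℝ → ℝ} (hh : LipschitzWith 1 h) (x : ℝ) :
    |∫ t in Iic x, (h t - h x) * gaussianPDFReal 0 1 t| ≤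
      x * (∫ t in Iic x, gaussianPDFReal 0 1 t) + gaussianPDFReal 0 1 x ∧
    |∫ t in Ioi x, (h t - h x) * gaussianPDFReal 0 1 t| ≤
      gaussianPDFReal 0 1 x - x * (∫ t in Ioi x, gaussianPDFReal 0 1 t) := by
  have hL : ∀ t, |h t - h x| ≤ |t - x| := fun t => by
    simpa [Real.dist_eq] using hh.dist_le_mul t x
  constructor
  · have e : x * (∫ t in Iic x, gaussianPDFReal 0 1 t) + gaussianPDFReal 0 1 x =
        ∫ t in Iic x, -((t - x) * gaussianPDFReal 0 1 t) := by
      rw [integral_neg, setIntegral_sub_gaussian, setIntegral_Iic_id_gaussian]; ring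
    rw [e, ← Real.norm_eq_abs]
    refine norm_integral_le_of_norm_le (integrable_sub_gaussian x).neg.integrableOn ?_
    refine (ae_restrict_iff' measurableSet_Iic).2 (ae_of_all _ fun t ht => ?_)
    have ht' : t ≤ x := ht
    rw [norm_mul, Real.norm_eq_abs, Real.norm_of_nonneg (gaussianPDFReal_nonneg 0 1 t), ← neg_mul]
    refine mul_le_mul_of_nonneg_right ?_ (gaussianPDFReal_nonneg 0 1 t)
    exact (hL t).trans (by rw [abs_of_nonpos (by linarith)])
  · have e : gaussianPDFReal 0 1 x - x * (∫ t in Ioi x, gaussianPDFReal 0 1 t) =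
        ∫ t in Ioi x, (t - x) * gaussianPDFReal 0 1 t := by
      rw [setIntegral_sub_gaussian, setIntegral_Ioi_id_gaussian]
    rw [e, ← Real.norm_eq_abs]
    refine norm_integral_le_of_norm_le (integrable_sub_gaussian x).integrableOn ?_
    refine (ae_restrict_iff' measurableSet_Ioi).2 (ae_of_all _ fun t ht => ?_)
    have ht' : x < t := ht
    rw [norm_mul, Real.norm_eq_abs, Real.norm_of_nonneg (gaussianPDFReal_nonneg 0 1 t)]
    refine mul_le_mul_of_nonneg_right ?_ (gaussianPDFReal_nonneg 0 1 t)
    exact (hL t).trans (by rw [abs_of_nonneg (by linarith)])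

/-- The quantity is the derivative of x f(x). Let I and J be the integrals of h(t) - h(x) against
the density over the lower and upper half-line, p and q the masses of these, and g the density at x.
Then it equals (I((1 + x²)q - xg) - J((1 + x²)p + xg)) / g. Mills' inequalities make both
coefficients nonnegative, and inserting the bounds |I| ≤ xp + g and |J| ≤ g - xq gives exactly 1;
h(t) = -t attains it. -/
lemma abs_steinSol_add_mul_deriv_le {h : ℝ → ℝ} (hh : LipschitzWith 1 h) (x : ℝ) :
    |steinSol h x + x * steinSolDeriv h x| ≤ 1 := by
  have hp := gaussianPDFReal_pos 0 1 x one_ne_zero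
  have hA := mills_Ioi x
  have hB := mills_Iic x
  obtain ⟨hI, hJ⟩ := abs_setIntegral_lipschitz_le hh x
  have hi := integrable_lipschitz_sub_gaussian hh x
  have hφ := integrable_gaussianPDFReal 0 1
  have hcompl : (Iic x)ᶜ = Ioi x := compl_Iic
  have hpq : (∫ t in Iic x, gaussianPDFReal 0 1 t) + ∫ t in Ioi x, gaussianPDFReal 0 1 t = 1 := by
    rw [← hcompl, integral_add_compl measurableSet_Iic hφ,
      integral_gaussianPDFReal_eq_one 0 one_ne_zero]
  have hm : ∫ y, h y ∂(gaussianReal 0 1) = h x +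
      ((∫ t in Iic x, (h t - h x) * gaussianPDFReal 0 1 t) +
        ∫ t in Ioi x, (h t - h x) * gaussianPDFReal 0 1 t) := by
    rw [← hcompl, integral_add_compl measurableSet_Iic hi, integral_gaussianReal_std]
    simp_rw [sub_mul]
    rw [integral_sub (integrable_lipschitz_gaussian hh) (hφ.const_mul _), integral_const_mul,
      integral_gaussianPDFReal_eq_one 0 one_ne_zero]
    ring
  have hf : ∫ t in Iic x, (h t - ∫ y, h y ∂(gaussianReal 0 1)) * gaussianPDFReal 0 1 t =
      (∫ t in Iic x, (h t - h x) * gaussianPDFReal 0 1 t) -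
      ((∫ t in Iic x, (h t - h x) * gaussianPDFReal 0 1 t) +
        ∫ t in Ioi x, (h t - h x) * gaussianPDFReal 0 1 t) *
          ∫ t in Iic x, gaussianPDFReal 0 1 t := by
    rw [← integral_const_mul, ← integral_sub hi.integrableOn (hφ.const_mul _).integrableOn]
    refine integral_congr_ae (ae_of_all _ fun t => ?_)
    simp only
    rw [hm]
    ring
  simp only [steinSolDeriv, steinSol]
  rw [hf, hm]
  generalize (∫ t in Iic x, (h t - h x) * gaussianPDFReal 0 1 t) = I at *
  generalize (∫ t in Ioi x, (h t - h x) * gaussianPDFReal 0 1 t) = J at *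
  generalize (∫ t in Iic x, gaussianPDFReal 0 1 t) = p at *
  generalize (∫ t in Ioi x, gaussianPDFReal 0 1 t) = q at *
  generalize gaussianPDFReal 0 1 x = g at *
  obtain rfl : q = 1 - p := by linarith
  have e : (I - (I + J) * p) / g + x * (x * ((I - (I + J) * p) / g) + (h x - (h x + (I + J)))) =
      (I * ((1 + x ^ 2) * (1 - p) - x * g) - J * ((1 + x ^ 2) * p + x * g)) / g := by
    field_simp
    ring
  rw [e, abs_div, abs_of_pos hp, div_le_one hp]
  calc _ ≤ |I * ((1 + x ^ 2) * (1 - p) - x * g)| + |J * ((1 + x ^ 2) * p + x * g)| := abs_sub _ _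
    _ = |I| * ((1 + x ^ 2) * (1 - p) - x * g) + |J| * ((1 + x ^ 2) * p + x * g) := by
        rw [abs_mul, abs_mul, abs_of_nonneg hA, abs_of_nonneg hB]
    _ ≤ (x * p + g) * ((1 + x ^ 2) * (1 - p) - x * g) +
        (g - x * (1 - p)) * ((1 + x ^ 2) * p + x * g) := by gcongr
    _ = g := by ring

lemma exists_abs_lipschitz_sub_le {h : ℝ → ℝ} (hh : LipschitzWith 1 h) (m : ℝ) :
    ∃ C, 0 ≤ C ∧ ∀ x, |h x - m| ≤ |x| + C := by
  refine ⟨|h 0 - m|, abs_nonneg _, fun x => ?_⟩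
  have h1 : |h x - h 0| ≤ |x| := by simpa [Real.dist_eq] using hh.dist_le_mul x 0
  calc |h x - m| = |(h x - h 0) + (h 0 - m)| := by ring_nf
    _ ≤ _ := (abs_add_le _ _).trans (by linarith)

/-- Stein's equation for a Lipschitz function `h` has a bounded solution `f` whose derivative is
bounded and `2`-Lipschitz. -/
theorem exists_stein_solution {h : ℝ → ℝ} (hh : LipschitzWith 1 h) :
    ∃ (f f' : ℝ → ℝ) (K : ℝ), (∀ x, HasDerivAt f (f' x) x) ∧ (∀ x y, |f' x - f' y| ≤ 2 * |x - y|) ∧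
      (∀ x, |f x| ≤ K) ∧ (∀ x, |f' x| ≤ K) ∧
      ∀ x, f' x - x * f x = h x - ∫ y, h y ∂(gaussianReal 0 1) := by
  obtain ⟨C, hC0, hC⟩ := exists_abs_lipschitz_sub_le hh (∫ y, h y ∂(gaussianReal 0 1))
  have hd := hasDerivAt_steinSol hh
  have hb := abs_steinSol_add_mul_deriv_le hh
  refine ⟨steinSol h, steinSolDeriv h, 2 + 2 * C, hd, fun x y => ?_, fun x => ?_, fun x => ?_,
    fun x => by simp [steinSolDeriv]⟩
  -- The constant 2 is 1 + 1: f' is x f(x) plus h up to a constant, and both are 1-Lipschitz.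
  · have h1 : ‖x * steinSol h x - y * steinSol h y‖ ≤ 1 * ‖x - y‖ := by
      refine convex_univ.norm_image_sub_le_of_norm_hasDerivWithin_le
        (f := fun x => x * steinSol h x) (f' := fun x => steinSol h x + x * steinSolDeriv h x)
        (fun z _ => ?_) (fun z _ => hb z) (mem_univ y) (mem_univ x)
      refine HasDerivAt.hasDerivWithinAt (((hasDerivAt_id' z).mul (hd z)).congr_deriv ?_)
      ring
    have h2 : |h x - h y| ≤ |x - y| := by simpa [Real.dist_eq] using hh.dist_le_mul x y
    rw [Real.norm_eq_abs, Real.norm_eq_abs] at h1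
    calc |steinSolDeriv h x - steinSolDeriv h y|
        = |(x * steinSol h x - y * steinSol h y) + (h x - h y)| := by
          simp only [steinSolDeriv]; ring_nf
      _ ≤ _ := (abs_add_le _ _).trans (by linarith)
  -- The relations f + x f' = O(1) and f' - x f = h - E h(Z) form a linear system for f and f'. Its
  -- determinant 1 + x² absorbs the at most quadratic growth of the right-hand sides.
  all_goals
    have hx := hb x
    have hx' := hC x
    have hs : 0 < 1 + x ^ 2 := by positivity
    have ha : |x| ≤ (1 + x ^ 2) / 2 := by
      nlinarith [sq_nonneg (|x| - 1), sq_abs x]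
  · have e : (1 + x ^ 2) * steinSol h x = (steinSol h x + x * steinSolDeriv h x) -
        x * (h x - ∫ y, h y ∂(gaussianReal 0 1)) := by simp only [steinSolDeriv]; ring
    refine le_of_mul_le_mul_left ?_ hs
    rw [← abs_of_pos hs, ← abs_mul, abs_of_pos hs, e]
    refine (abs_sub _ _).trans ?_
    rw [abs_mul]
    nlinarith [mul_le_mul_of_nonneg_left hx' (abs_nonneg x), sq_abs x,
      mul_le_mul_of_nonneg_right ha hC0]
  · have e : (1 + x ^ 2) * steinSolDeriv h x = x * (steinSol h x + x * steinSolDeriv h x) +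
        (h x - ∫ y, h y ∂(gaussianReal 0 1)) := by simp only [steinSolDeriv]; ring
    refine le_of_mul_le_mul_left ?_ hs
    rw [← abs_of_pos hs, ← abs_mul, abs_of_pos hs, e]
    refine (abs_add_le _ _).trans ?_
    rw [abs_mul]
    nlinarith [mul_le_mul_of_nonneg_left hx (abs_nonneg x), sq_abs x,
      mul_nonneg (sq_nonneg x) hC0]

/-- Taylor's formula of order one for a function with Lipschitz derivative. -/
lemma abs_taylor_le {F F' : ℝ → ℝ} {L : ℝ} (hF : ∀ x, HasDerivAt F (F' x) x)
    (hL : ∀ x y, |F' x - F' y| ≤ L * |x - y|) (x y : ℝ) :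
    |F y - F x - F' x * (y - x)| ≤ L / 2 * (y - x) ^ 2 := by
  have hL0 : 0 ≤ L := by simpa using (abs_nonneg _).trans (hL 1 0)
  have key := image_norm_le_of_norm_deriv_right_le_deriv_boundary
    (f := fun t : ℝ => F (x + t * (y - x)) - F x - t * (F' x * (y - x)))
    (f' := fun t => F' (x + t * (y - x)) * (y - x) - F' x * (y - x))
    (B := fun t => L / 2 * (y - x) ^ 2 * t ^ 2) (B' := fun t => L * (y - x) ^ 2 * t)
    (a := 0) (b := 1) ?_ ?_ ?_ ?_ ?_ (x := 1) (by simp)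
  · simpa using key
  · have : Continuous F := continuous_iff_continuousAt.2 fun x => (hF x).continuousAt
    fun_prop
  · intro t _
    refine HasDerivAt.hasDerivWithinAt ?_
    have h1 : HasDerivAt (fun t : ℝ => x + t * (y - x)) (y - x) t := by
      simpa using ((hasDerivAt_id' t).mul_const (y - x)).const_add x
    have h2 := (hF (x + t * (y - x))).comp t h1
    have h3 : HasDerivAt (fun t : ℝ => t * (F' x * (y - x))) (F' x * (y - x)) t := by
      simpa using (hasDerivAt_id' t).mul_const (F' x * (y - x))
    exact (h2.sub_const _).sub h3
  · simp
  · intro t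
    have := (hasDerivAt_pow 2 t).const_mul (L / 2 * (y - x) ^ 2)
    refine this.congr_deriv ?_
    simp; ring
  · intro t ht
    have := hL (x + t * (y - x)) x
    rw [Real.norm_eq_abs, ← sub_mul, abs_mul]
    calc _ ≤ L * |x + t * (y - x) - x| * |y - x| := by gcongr
      _ = _ := by
        rw [add_sub_cancel_left, abs_mul, abs_of_nonneg ht.1]
        rw [← sq_abs (y - x)]; ring

/-! ### Moments and independent copies -/

lemma integrable_abs_pow_three_iff {Ω : Type*} [MeasurableSpace Ω] {P : Measure Ω} {Y : Ω → ℝ}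
    (hY : AEStronglyMeasurable Y P) :
    Integrable (fun ω => |Y ω| ^ 3) P ↔ MemLp Y 3 P := by
  have := integrable_norm_rpow_iff hY (p := 3) (by norm_num) (by norm_num)
  rw [← this]
  norm_num

lemma integral_sub_mean_mul {E : Type*} [MeasurableSpace E] {ν : Measure E} {u v : E → ℝ}
    (hv : Integrable v ν)
    (huv : Integrable (fun x => u x * v x) ν) :
    ∫ x, (u x - ∫ y, u y ∂ν) * v x ∂ν = ∫ x, u x * v x ∂ν - (∫ x, u x ∂ν) * ∫ x, v x ∂ν := by
  simp_rw [sub_mul]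
  rw [integral_sub huv (hv.const_mul _), integral_const_mul]

section Pair

variable {E : Type*} [MeasurableSpace E] {ν : Measure E} [IsProbabilityMeasure ν] {u v : E → ℝ}

lemma integrable_prod_sub_mul_sub (hu : Integrable u ν) (hv : Integrable v ν)
    (huv : Integrable (fun x => u x * v x) ν) :
    Integrable (fun z : E × E => (u z.1 - u z.2) * (v z.1 - v z.2)) (ν.prod ν) := by
  have h := ((huv.comp_fst ν).sub (hu.mul_prod hv)).sub
    ((hv.mul_prod hu).sub (huv.comp_snd ν))
  refine h.congr (ae_of_all _ fun z => ?_)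
  simp only [Pi.sub_apply]
  ring

/-- The covariance as an integral over two independent copies. -/
lemma integral_prod_sub_mul_sub (hu : Integrable u ν) (hv : Integrable v ν)
    (huv : Integrable (fun x => u x * v x) ν) :
    ∫ z : E × E, (u z.1 - u z.2) * (v z.1 - v z.2) ∂(ν.prod ν) =
      2 * (∫ x, u x * v x ∂ν - (∫ x, u x ∂ν) * ∫ x, v x ∂ν) := by
  have e : (fun z : E × E => (u z.1 - u z.2) * (v z.1 - v z.2)) = fun z =>
      (u z.1 * v z.1 - u z.1 * v z.2) - (v z.1 * u z.2 - u z.2 * v z.2) := by ext z; ring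
  have h1 := huv.comp_fst ν
  have h2 := huv.comp_snd ν
  have h3 := hu.mul_prod hv
  have h4 := hv.mul_prod hu
  rw [e, integral_sub (by exact h1.sub h3) (by exact h4.sub h2), integral_sub h1 h3,
    integral_sub h4 h2, integral_prod_mul, integral_prod_mul,
    integral_fun_fst (fun x => u x * v x), integral_fun_snd (fun x => u x * v x)]
  simp
  ring

end Pair

/-- Chebyshev's association inequality: Y² and |Y| are both increasing in |Y|, so their covariance,
written with two independent copies, is nonnegative. -/
lemma integral_sq_mul_integral_abs_le {Ω : Type*} [MeasurableSpace Ω] {P : Measure Ω}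
    [IsProbabilityMeasure P] {Y : Ω → ℝ} (hY : MemLp Y 3 P) :
    (∫ ω, Y ω ^ 2 ∂P) * (∫ ω, |Y ω| ∂P) ≤ ∫ ω, |Y ω| ^ 3 ∂P := by
  have h1 : Integrable (fun ω => |Y ω|) P := (hY.integrable (by norm_num)).abs
  have h2 : Integrable (fun ω => Y ω ^ 2) P :=
    (hY.mono_exponent (by norm_num : (2 : ℝ≥0∞) ≤ 3)).integrable_sq
  have h3 : Integrable (fun ω => |Y ω| ^ 3) P :=
    (integrable_abs_pow_three_iff hY.aestronglyMeasurable).2 hY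
  have e : (fun ω => Y ω ^ 2 * |Y ω|) = fun ω => |Y ω| ^ 3 := by
    ext ω; rw [← sq_abs]; ring
  have key := integral_prod_sub_mul_sub h2 h1 (by rw [e]; exact h3)
  rw [e] at key
  have hn : 0 ≤ ∫ z : Ω × Ω, (Y z.1 ^ 2 - Y z.2 ^ 2) * (|Y z.1| - |Y z.2|) ∂(P.prod P) := by
    refine integral_nonneg fun z => ?_
    have : (Y z.1 ^ 2 - Y z.2 ^ 2) * (|Y z.1| - |Y z.2|) =
        (|Y z.1| - |Y z.2|) ^ 2 * (|Y z.1| + |Y z.2|) := by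
      rw [← sq_abs (Y z.1), ← sq_abs (Y z.2)]; ring
    simp only [Pi.zero_apply]
    rw [this]
    positivity
  linarith

lemma integral_abs_le_sqrt_integral_sq {Ω : Type*} [MeasurableSpace Ω] {P : Measure Ω}
    [IsProbabilityMeasure P] {Y : Ω → ℝ} (hY : MemLp Y 2 P) :
    ∫ ω, |Y ω| ∂P ≤ √(∫ ω, Y ω ^ 2 ∂P) := by
  refine Real.le_sqrt_of_sq_le ?_
  have := variance_nonneg (fun ω => |Y ω|) P
  rw [variance_eq_sub (show MemLp (fun ω => |Y ω|) 2 P from hY.abs)] at this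
  simp only [Pi.pow_apply, sq_abs] at this
  linarith

/-! ### Test functions -/

/-- A bounded differentiable function `F` with bounded and `L`-Lipschitz derivative `F'`. -/
structure IsTestFun (F F' : ℝ → ℝ) (K L : ℝ) : Prop where
  hasDerivAt : ∀ x, HasDerivAt F (F' x) x
  lip : ∀ x y, |F' x - F' y| ≤ L * |x - y|
  bdd : ∀ x, |F x| ≤ K
  bdd_deriv : ∀ x, |F' x| ≤ K

namespace IsTestFun

variable {F F' : ℝ → ℝ} {K L : ℝ}

lemma lip_nonneg (hF : IsTestFun F F' K L) : 0 ≤ L := by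
  simpa using (abs_nonneg _).trans (hF.lip 1 0)

lemma continuous (hF : IsTestFun F F' K L) : Continuous F :=
  continuous_iff_continuousAt.2 fun x => (hF.hasDerivAt x).continuousAt

lemma continuous_deriv (hF : IsTestFun F F' K L) : Continuous F' := by
  have : LipschitzWith L.toNNReal F' := LipschitzWith.of_dist_le_mul fun x y => by
    rw [Real.coe_toNNReal _ hF.lip_nonneg]; exact hF.lip x y
  exact this.continuous

variable {Ω : Type*} [MeasurableSpace Ω] {P : Measure Ω} {T Y : Ω → ℝ}

lemma integrable_comp [IsFiniteMeasure P] (hF : IsTestFun F F' K L) (hT : Measurable T) :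
    Integrable (fun ω => F (T ω)) P :=
  Integrable.of_bound (hF.continuous.measurable.comp hT).aestronglyMeasurable K
    (ae_of_all _ fun _ => hF.bdd _)

lemma integrable_deriv_comp [IsFiniteMeasure P] (hF : IsTestFun F F' K L) (hT : Measurable T) :
    Integrable (fun ω => F' (T ω)) P :=
  Integrable.of_bound (hF.continuous_deriv.measurable.comp hT).aestronglyMeasurable K
    (ae_of_all _ fun _ => hF.bdd_deriv _)

lemma integrable_mul_comp (hF : IsTestFun F F' K L) (hY : Integrable Y P) (hT : Measurable T) :
    Integrable (fun ω => Y ω * F (T ω)) P :=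
  hY.mul_bdd (c := K) (hF.continuous.measurable.comp hT).aestronglyMeasurable
    (ae_of_all _ fun _ => hF.bdd _)

lemma integrable_mul_deriv_comp (hF : IsTestFun F F' K L) (hY : Integrable Y P)
    (hT : Measurable T) : Integrable (fun ω => Y ω * F' (T ω)) P :=
  hY.mul_bdd (c := K) (hF.continuous_deriv.measurable.comp hT).aestronglyMeasurable
    (ae_of_all _ fun _ => hF.bdd_deriv _)

lemma abs_integral_comp_le [IsProbabilityMeasure P] (hF : IsTestFun F F' K L) :
    |∫ ω, F (T ω) ∂P| ≤ K := by
  simpa using norm_integral_le_of_norm_le_const (μ := P) (f := fun ω => F (T ω))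
    (ae_of_all _ fun ω => hF.bdd (T ω))

lemma abs_integral_deriv_comp_le [IsProbabilityMeasure P] (hF : IsTestFun F F' K L) :
    |∫ ω, F' (T ω) ∂P| ≤ K := by
  simpa using norm_integral_le_of_norm_le_const (μ := P) (f := fun ω => F' (T ω))
    (ae_of_all _ fun ω => hF.bdd_deriv (T ω))

lemma abs_integral_deriv_sub_le [IsFiniteMeasure P] (hF : IsTestFun F F' K L) {U : Ω → ℝ}
    (hT : Measurable T) (hU : Measurable U) (hi : Integrable (fun ω => |T ω - U ω|) P) :
    |∫ ω, F' (T ω) ∂P - ∫ ω, F' (U ω) ∂P| ≤ L * ∫ ω, |T ω - U ω| ∂P := by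
  rw [← integral_sub (hF.integrable_deriv_comp hT) (hF.integrable_deriv_comp hU),
    ← integral_const_mul]
  exact norm_integral_le_of_norm_le (f := fun ω => F' (T ω) - F' (U ω)) (hi.const_mul L)
    (ae_of_all _ fun ω => hF.lip (T ω) (U ω))

/-- Stein's identity for one independent summand, up to a third moment. -/
lemma abs_integral_sub_mean_mul_comp_le [IsProbabilityMeasure P] (hF : IsTestFun F F' K L)
    (hT : Measurable T) (hY : Measurable Y) (hYT : IndepFun Y T P) (hY3 : MemLp Y 3 P) :
    |∫ ω, (Y ω - ∫ ω', Y ω' ∂P) * F (T ω + Y ω) ∂P - Var[Y; P] * ∫ ω, F' (T ω + Y ω) ∂P| ≤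
      3 * L / 2 * ∫ ω, |Y ω - ∫ ω', Y ω' ∂P| ^ 3 ∂P := by
  set a := ∫ ω', Y ω' ∂P with ha
  have hL := hF.lip_nonneg
  have hZ3 : MemLp (fun ω => Y ω - a) 3 P := hY3.sub (memLp_const a)
  have hZ1 : Integrable (fun ω => Y ω - a) P := hZ3.integrable (by norm_num)
  have hZ2 : Integrable (fun ω => (Y ω - a) ^ 2) P :=
    (hZ3.mono_exponent (by norm_num : (2 : ℝ≥0∞) ≤ 3)).integrable_sq
  have hZ3' : Integrable (fun ω => |Y ω - a| ^ 3) P :=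
    (integrable_abs_pow_three_iff hZ3.aestronglyMeasurable).2 hZ3
  have hTa : Measurable (fun ω => T ω + a) := hT.add_const a
  have hTY : Measurable (fun ω => T ω + Y ω) := hT.add hY
  have hvar : Var[Y; P] = ∫ ω, (Y ω - a) ^ 2 ∂P := variance_eq_integral hY.aemeasurable
  -- Expanding around T + a rather than T makes the increment the centred variable Y - a, so only
  -- central moments appear. By independence the zeroth-order term vanishes and the first-order term
  -- is Var(Y) E F'(T + a).
  have h0 : ∫ ω, (Y ω - a) * F (T ω + a) ∂P = 0 := by
    have hind : IndepFun (fun ω => Y ω - a) (fun ω => F (T ω + a)) P :=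
      hYT.comp (φ := fun y => y - a) (ψ := fun t => F (t + a)) (by fun_prop)
        (hF.continuous.measurable.comp (by fun_prop))
    rw [hind.integral_fun_mul_eq_mul_integral hZ1.aestronglyMeasurable
      (hF.integrable_comp hTa).aestronglyMeasurable,
      integral_sub (hY3.integrable (by norm_num)) (integrable_const a)]
    simp [← ha]
  have h1 : ∫ ω, (Y ω - a) ^ 2 * F' (T ω + a) ∂P = Var[Y; P] * ∫ ω, F' (T ω + a) ∂P := by
    have hind : IndepFun (fun ω => (Y ω - a) ^ 2) (fun ω => F' (T ω + a)) P :=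
      hYT.comp (φ := fun y => (y - a) ^ 2) (ψ := fun t => F' (t + a)) (by fun_prop)
        (hF.continuous_deriv.measurable.comp (by fun_prop))
    rw [hind.integral_fun_mul_eq_mul_integral hZ2.aestronglyMeasurable
      (hF.integrable_deriv_comp hTa).aestronglyMeasurable, hvar]
  have i0 := hF.integrable_mul_comp hZ1 hTY
  have i1 := hF.integrable_mul_comp hZ1 hTa
  have i2 := hF.integrable_mul_deriv_comp hZ2 hTa
  have hrem : |∫ ω, ((Y ω - a) * F (T ω + Y ω) - (Y ω - a) * F (T ω + a)
      - (Y ω - a) ^ 2 * F' (T ω + a)) ∂P| ≤ L / 2 * ∫ ω, |Y ω - a| ^ 3 ∂P := by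
    rw [← integral_const_mul, ← Real.norm_eq_abs]
    refine norm_integral_le_of_norm_le (hZ3'.const_mul _) (ae_of_all _ fun ω => ?_)
    have ht := abs_taylor_le hF.hasDerivAt hF.lip (T ω + a) (T ω + Y ω)
    have e : (Y ω - a) * F (T ω + Y ω) - (Y ω - a) * F (T ω + a)
      - (Y ω - a) ^ 2 * F' (T ω + a) = (Y ω - a) * (F (T ω + Y ω) - F (T ω + a) -
        F' (T ω + a) * ((T ω + Y ω) - (T ω + a))) := by ring
    rw [e, norm_mul, Real.norm_eq_abs, Real.norm_eq_abs]
    calc _ ≤ |Y ω - a| * (L / 2 * ((T ω + Y ω) - (T ω + a)) ^ 2) := by gcongr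
      _ = _ := by rw [← sq_abs]; ring_nf
  rw [integral_sub (by exact i0.sub i1) i2, integral_sub i0 i1, h0, h1] at hrem
  -- Moving the argument of F' back to T + Y costs L Var(Y) E|Y - a| ≤ L E|Y - a|³. Together with
  -- the Taylor remainder L/2 this makes 3L/2.
  have hdiff : |Var[Y; P] * ∫ ω, F' (T ω + a) ∂P - Var[Y; P] * ∫ ω, F' (T ω + Y ω) ∂P| ≤
      L * ∫ ω, |Y ω - a| ^ 3 ∂P := by
    rw [← mul_sub, abs_mul, abs_of_nonneg (variance_nonneg _ _)]
    have e : ∀ ω, |T ω + a - (T ω + Y ω)| = |Y ω - a| := fun ω => by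
      rw [abs_sub_comm]; ring_nf
    have hs := hF.abs_integral_deriv_sub_le (P := P) hTa hTY (by simp_rw [e]; exact hZ1.abs)
    simp_rw [e] at hs
    calc _ ≤ Var[Y; P] * (L * ∫ ω, |Y ω - a| ∂P) := by
          gcongr
          exact variance_nonneg _ _
      _ = L * ((∫ ω, (Y ω - a) ^ 2 ∂P) * ∫ ω, |Y ω - a| ∂P) := by rw [hvar]; ring
      _ ≤ _ := by gcongr; exact integral_sq_mul_integral_abs_le hZ3
  have := abs_add_le _ _ |>.trans (add_le_add hrem hdiff)
  refine (le_of_eq ?_).trans (this.trans (le_of_eq ?_))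
  · congr 1; ring
  · ring

end IsTestFun

/-! ### Partial sums of an i.i.d. sequence -/

lemma memLp_of_identDistrib {Ω : Type*} [MeasurableSpace Ω] {P : Measure Ω}
    {X : ℕ → Ω → ℝ} (hX3 : MemLp (X 0) 3 P)
    (hXident : ∀ j, IdentDistrib (X j) (X 0) P P) (j : ℕ) : MemLp (X j) 3 P :=
  (hXident j).symm.memLp_snd hX3

lemma partialSum_sub {Ω : Type*} {X : ℕ → Ω → ℝ} (k l : ℕ) (hkl : k ≤ l) (ω : Ω) :
    ∑ j ∈ Finset.range l, X j ω - ∑ j ∈ Finset.range k, X j ω = ∑ j ∈ Finset.Ico k l, X j ω :=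
  (Finset.sum_Ico_eq_sub _ hkl).symm

section PartialSums

variable {Ω : Type*} [MeasurableSpace Ω] {P : Measure Ω} [IsProbabilityMeasure P]
  {X : ℕ → Ω → ℝ} {F F' : ℝ → ℝ} {K L : ℝ}

lemma measurable_partialSum (hX : ∀ j, Measurable (X j)) (k : ℕ) :
    Measurable (fun ω => ∑ j ∈ Finset.range k, X j ω) :=
  Finset.measurable_fun_sum _ fun j _ => hX j

/-- Stein's identity for a partial sum, up to third moments. -/
lemma abs_integral_partialSum_mul_comp_le (hF : IsTestFun F F' K L) (hX : ∀ j, Measurable (X j))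
    (hXindep : iIndepFun X P) (hXident : ∀ j, IdentDistrib (X j) (X 0) P P)
    (hX3 : MemLp (X 0) 3 P) {a : ℝ} (ha : a = ∫ ω, X 0 ω ∂P) (k : ℕ) :
    |∫ ω, (∑ j ∈ Finset.range k, X j ω - k * a) * F (∑ j ∈ Finset.range k, X j ω) ∂P -
        k * Var[X 0; P] * ∫ ω, F' (∑ j ∈ Finset.range k, X j ω) ∂P| ≤
      k * (3 * L / 2 * ∫ ω, |X 0 ω - a| ^ 3 ∂P) := by
  have hS := measurable_partialSum hX k
  have hint : ∀ j, Integrable (fun ω => X j ω - a) P := fun j =>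
    ((memLp_of_identDistrib hX3 hXident j).integrable (by norm_num)).sub (integrable_const a)
  have e1 : ∫ ω, (∑ j ∈ Finset.range k, X j ω - k * a) * F (∑ j ∈ Finset.range k, X j ω) ∂P =
      ∑ i ∈ Finset.range k, ∫ ω, (X i ω - a) * F (∑ j ∈ Finset.range k, X j ω) ∂P := by
    rw [← integral_finsetSum _ fun i _ => hF.integrable_mul_comp (hint i) hS]
    refine integral_congr_ae (ae_of_all _ fun ω => ?_)
    simp only [← Finset.sum_mul, Finset.sum_sub_distrib]
    simp
  have e2 : k * Var[X 0; P] * ∫ ω, F' (∑ j ∈ Finset.range k, X j ω) ∂P =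
      ∑ i ∈ Finset.range k, Var[X 0; P] * ∫ ω, F' (∑ j ∈ Finset.range k, X j ω) ∂P := by
    simp [mul_assoc]
  have e3 : k * (3 * L / 2 * ∫ ω, |X 0 ω - a| ^ 3 ∂P) =
      ∑ i ∈ Finset.range k, (3 * L / 2 * ∫ ω, |X 0 ω - a| ^ 3 ∂P) := by simp
  rw [e1, e2, e3, ← Finset.sum_sub_distrib]
  refine (Finset.abs_sum_le_sum_abs _ _).trans (Finset.sum_le_sum fun i hi => ?_)
  have hai : ∫ ω, X i ω ∂P = a := ha ▸ (hXident i).integral_eq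
  have hTm : Measurable (fun ω => ∑ j ∈ (Finset.range k).erase i, X j ω) :=
    Finset.measurable_fun_sum _ fun j _ => hX j
  have hind : IndepFun (X i) (fun ω => ∑ j ∈ (Finset.range k).erase i, X j ω) P := by
    have := (hXindep.indepFun_finsetSum_of_notMem hX (Finset.notMem_erase i (Finset.range k))).symm
    convert this using 1
    ext ω; simp
  have key := hF.abs_integral_sub_mean_mul_comp_le hTm (hX i) hind
    (memLp_of_identDistrib hX3 hXident i)
  have e4 : ∫ ω, |X i ω - a| ^ 3 ∂P = ∫ ω, |X 0 ω - a| ^ 3 ∂P :=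
    ((hXident i).comp (u := fun x => |x - a| ^ 3) (by fun_prop)).integral_eq
  simp_rw [Finset.sum_erase_add _ _ hi] at key
  rwa [hai, (hXident i).variance_eq, e4] at key

/-- Cauchy–Schwarz, without independence. Quadratic growth in l - k is good enough, since it is the
order of the Taylor remainder wanted for k ↦ E F(S_k). -/
lemma integral_sq_sum_Ico_le (hXident : ∀ j, IdentDistrib (X j) (X 0) P P)
    (hX3 : MemLp (X 0) 3 P) (k l : ℕ) (hkl : k ≤ l) :
    Integrable (fun ω => (∑ j ∈ Finset.Ico k l, X j ω) ^ 2) P ∧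
    ∫ ω, (∑ j ∈ Finset.Ico k l, X j ω) ^ 2 ∂P ≤ ((l : ℝ) - k) ^ 2 * ∫ ω, X 0 ω ^ 2 ∂P := by
  have hm : ∀ j, MemLp (X j) 2 P := fun j =>
    (memLp_of_identDistrib hX3 hXident j).mono_exponent (by norm_num)
  have hi : Integrable (fun ω => (∑ j ∈ Finset.Ico k l, X j ω) ^ 2) P :=
    (memLp_finsetSum _ fun j _ => hm j).integrable_sq
  refine ⟨hi, ?_⟩
  have hsq : ∀ j, ∫ ω, X j ω ^ 2 ∂P = ∫ ω, X 0 ω ^ 2 ∂P := fun j =>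
    ((hXident j).comp (u := fun x => x ^ 2) (by fun_prop)).integral_eq
  have hle : ∫ ω, (∑ j ∈ Finset.Ico k l, X j ω) ^ 2 ∂P ≤
      ∫ ω, ((l : ℝ) - k) * ∑ j ∈ Finset.Ico k l, X j ω ^ 2 ∂P := by
    refine integral_mono hi ((integrable_finsetSum _ fun j _ =>
      (hm j).integrable_sq).const_mul _) fun ω => ?_
    have := sq_sum_le_card_mul_sum_sq (s := Finset.Ico k l) (f := fun j => X j ω)
    simpa [Nat.cast_sub hkl] using this
  refine hle.trans (le_of_eq ?_)
  rw [integral_const_mul, integral_finsetSum _ fun j _ => (hm j).integrable_sq]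
  simp [hsq, Nat.cast_sub hkl]
  ring

lemma integral_abs_sum_Ico_le (hXident : ∀ j, IdentDistrib (X j) (X 0) P P)
    (hX3 : MemLp (X 0) 3 P) (k l : ℕ) (hkl : k ≤ l) :
    ∫ ω, |∑ j ∈ Finset.Ico k l, X j ω| ∂P ≤ ((l : ℝ) - k) * √(∫ ω, X 0 ω ^ 2 ∂P) := by
  have hm : MemLp (fun ω => ∑ j ∈ Finset.Ico k l, X j ω) 2 P := memLp_finsetSum _ fun j _ =>
    (memLp_of_identDistrib hX3 hXident j).mono_exponent (by norm_num)
  refine (integral_abs_le_sqrt_integral_sq hm).trans ?_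
  have h0 : (0 : ℝ) ≤ l - k := sub_nonneg.2 (by exact_mod_cast hkl)
  calc _ ≤ √(((l : ℝ) - k) ^ 2 * ∫ ω, X 0 ω ^ 2 ∂P) :=
        Real.sqrt_le_sqrt (integral_sq_sum_Ico_le hXident hX3 k l hkl).2
    _ = _ := by rw [Real.sqrt_mul (sq_nonneg _), Real.sqrt_sq h0]

/-- Two partial sums differ by |k - l| summands, each of L² norm b. This provides the Lipschitz
hypothesis of the index estimates, with D = L b. -/
lemma abs_integral_deriv_partialSum_sub_le (hF : IsTestFun F F' K L) (hX : ∀ j, Measurable (X j))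
    (hXident : ∀ j, IdentDistrib (X j) (X 0) P P) (hX3 : MemLp (X 0) 3 P) (k l : ℕ) :
    |∫ ω, F' (∑ j ∈ Finset.range k, X j ω) ∂P - ∫ ω, F' (∑ j ∈ Finset.range l, X j ω) ∂P| ≤
      L * √(∫ ω, X 0 ω ^ 2 ∂P) * |(k : ℝ) - l| := by
  wlog hkl : k ≤ l generalizing k l
  · rw [abs_sub_comm, abs_sub_comm (k : ℝ)]
    exact this l k (by omega)
  have h0 : (0 : ℝ) ≤ l - k := sub_nonneg.2 (by exact_mod_cast hkl)
  rw [abs_sub_comm, abs_sub_comm (k : ℝ), abs_of_nonneg h0]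
  have hi : Integrable (fun ω => ∑ j ∈ Finset.Ico k l, X j ω) P := integrable_finsetSum _ fun j _ =>
    (memLp_of_identDistrib hX3 hXident j).integrable (by norm_num)
  have h := hF.abs_integral_deriv_sub_le (P := P) (measurable_partialSum hX l)
    (measurable_partialSum hX k) (by simp_rw [partialSum_sub k l hkl]; exact hi.abs)
  simp_rw [partialSum_sub k l hkl] at h
  refine h.trans ?_
  calc _ ≤ L * (((l : ℝ) - k) * √(∫ ω, X 0 ω ^ 2 ∂P)) :=
        mul_le_mul_of_nonneg_left (integral_abs_sum_Ico_le hXident hX3 k l hkl) hF.lip_nonneg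
    _ = _ := by ring

/-- The expansion is around the smaller index because S_k is independent of the later summands; the
linear term E[(S_l - S_k) F'(S_k)] therefore factorises. -/
lemma abs_integral_partialSum_taylor_le (hF : IsTestFun F F' K L) (hX : ∀ j, Measurable (X j))
    (hXindep : iIndepFun X P) (hXident : ∀ j, IdentDistrib (X j) (X 0) P P)
    (hX3 : MemLp (X 0) 3 P) {a : ℝ} (ha : a = ∫ ω, X 0 ω ∂P) (k l : ℕ) (hkl : k ≤ l) :
    |∫ ω, F (∑ j ∈ Finset.range l, X j ω) ∂P - ∫ ω, F (∑ j ∈ Finset.range k, X j ω) ∂P -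
        a * ((l : ℝ) - k) * ∫ ω, F' (∑ j ∈ Finset.range k, X j ω) ∂P| ≤
      L / 2 * (∫ ω, X 0 ω ^ 2 ∂P) * ((l : ℝ) - k) ^ 2 := by
  have hSk := measurable_partialSum hX k
  have hSl := measurable_partialSum hX l
  have hi : ∀ j, Integrable (X j) P := fun j =>
    (memLp_of_identDistrib hX3 hXident j).integrable (by norm_num)
  have e : ∫ ω, (∑ j ∈ Finset.Ico k l, X j ω) * F' (∑ j ∈ Finset.range k, X j ω) ∂P =
      a * ((l : ℝ) - k) * ∫ ω, F' (∑ j ∈ Finset.range k, X j ω) ∂P := by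
    simp_rw [Finset.sum_mul]
    rw [integral_finsetSum _ fun j _ => hF.integrable_mul_deriv_comp (hi j) hSk]
    have : ∀ j ∈ Finset.Ico k l, ∫ ω, X j ω * F' (∑ j ∈ Finset.range k, X j ω) ∂P =
        a * ∫ ω, F' (∑ j ∈ Finset.range k, X j ω) ∂P := by
      intro j hj
      have hj' : j ∉ Finset.range k := by simpa using (Finset.mem_Ico.1 hj).1
      have h0 : IndepFun (fun ω => ∑ j ∈ Finset.range k, X j ω) (X j) P := by
        convert hXindep.indepFun_finsetSum_of_notMem hX hj' using 1
        ext ω; simp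
      have hind : IndepFun (X j) (fun ω => F' (∑ j ∈ Finset.range k, X j ω)) P :=
        h0.symm.comp measurable_id hF.continuous_deriv.measurable
      rw [hind.integral_fun_mul_eq_mul_integral (hi j).aestronglyMeasurable
        (hF.integrable_deriv_comp hSk).aestronglyMeasurable, (hXident j).integral_eq, ← ha]
    rw [Finset.sum_congr rfl this]
    simp [Nat.cast_sub hkl]
    ring
  have hI : Integrable (fun ω => ∑ j ∈ Finset.Ico k l, X j ω) P :=
    integrable_finsetSum _ fun j _ => hi j
  rw [← e, ← integral_sub (hF.integrable_comp hSl) (hF.integrable_comp hSk),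
    ← integral_sub (by exact (hF.integrable_comp hSl).sub (hF.integrable_comp hSk))
      (hF.integrable_mul_deriv_comp hI hSk)]
  obtain ⟨hsi, hsq⟩ := integral_sq_sum_Ico_le hXident hX3 k l hkl
  have hL : 0 ≤ L / 2 := by have := hF.lip_nonneg; positivity
  rw [← Real.norm_eq_abs]
  calc _ ≤ ∫ ω, L / 2 * (∑ j ∈ Finset.Ico k l, X j ω) ^ 2 ∂P := by
        refine norm_integral_le_of_norm_le (hsi.const_mul _) (ae_of_all _ fun ω => ?_)
        have ht := abs_taylor_le hF.hasDerivAt hF.lip (∑ j ∈ Finset.range k, X j ω)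
          (∑ j ∈ Finset.range l, X j ω)
        rw [partialSum_sub k l hkl, mul_comm (F' _)] at ht
        exact ht
    _ ≤ L / 2 * (((l : ℝ) - k) ^ 2 * ∫ ω, X 0 ω ^ 2 ∂P) := by
        rw [integral_const_mul]
        exact mul_le_mul_of_nonneg_left hsq hL
    _ = _ := by ring

/-- The expansion of `k ↦ E[F (S_k)]` around the smaller of two indices. -/
lemma abs_integral_partialSum_taylor_min_le (hF : IsTestFun F F' K L) (hX : ∀ j, Measurable (X j))
    (hXindep : iIndepFun X P) (hXident : ∀ j, IdentDistrib (X j) (X 0) P P)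
    (hX3 : MemLp (X 0) 3 P) {a : ℝ} (ha : a = ∫ ω, X 0 ω ∂P) (k l : ℕ) :
    |∫ ω, F (∑ j ∈ Finset.range l, X j ω) ∂P - ∫ ω, F (∑ j ∈ Finset.range k, X j ω) ∂P -
        a * ((l : ℝ) - k) * ∫ ω, F' (∑ j ∈ Finset.range (min k l), X j ω) ∂P| ≤
      L / 2 * (∫ ω, X 0 ω ^ 2 ∂P) * ((l : ℝ) - k) ^ 2 := by
  rcases le_total k l with h | h
  · rw [min_eq_left h]
    exact abs_integral_partialSum_taylor_le hF hX hXindep hXident hX3 ha k l h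
  · rw [min_eq_right h]
    have := abs_integral_partialSum_taylor_le hF hX hXindep hXident hX3 ha l k h
    rw [← abs_neg]
    calc _ = _ := by congr 1; ring
      _ ≤ _ := this
      _ = _ := by ring

end PartialSums

/-! ### Stein's identity for one summand of the index -/

section Index

/-- The third moment controls the lower moments of a probability measure. -/
lemma integrable_pow_of_integrable_pow_three {ν : Measure ℝ} [IsProbabilityMeasure ν]
    (h3 : Integrable (fun m : ℝ => m ^ 3) ν) :
    Integrable (fun m : ℝ => m) ν ∧ Integrable (fun m : ℝ => m ^ 2) ν := by
  have h : MemLp (fun m : ℝ => m) 3 ν := by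
    rw [← integrable_abs_pow_three_iff (by fun_prop)]
    simpa [abs_pow] using h3.abs
  exact ⟨h.integrable (by norm_num),
    (h.mono_exponent (by norm_num : (2 : ℝ≥0∞) ≤ 3)).integrable_sq⟩

/-- `E[M] Var[M] ≤ Cov(M, M²)` for a nonnegative random variable `M`. -/
lemma mean_mul_variance_le {ν : Measure ℝ} [IsProbabilityMeasure ν] (h0 : ∀ᵐ m ∂ν, 0 ≤ m)
    (h3 : Integrable (fun m : ℝ => m ^ 3) ν) :
    (∫ m, m ∂ν) * (∫ m, m ^ 2 ∂ν - (∫ m, m ∂ν) ^ 2) ≤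
      ∫ m, m ^ 3 ∂ν - (∫ m, m ∂ν) * ∫ m, m ^ 2 ∂ν := by
  obtain ⟨h1, h2⟩ := integrable_pow_of_integrable_pow_three h3
  set α := ∫ m, m ∂ν with hα
  -- E[M(M - α)²] is exactly Cov(M, M²) - α Var(M).
  have hn : 0 ≤ ∫ m, m * (m - α) ^ 2 ∂ν :=
    integral_nonneg_of_ae (h0.mono fun m hm => mul_nonneg hm (sq_nonneg _))
  have e : (fun m : ℝ => m * (m - α) ^ 2) = fun m => m ^ 3 - 2 * α * m ^ 2 + α ^ 2 * m := by
    ext m; ring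
  rw [e, integral_add (by exact h3.sub (h2.const_mul _)) (h1.const_mul _),
    integral_sub h3 (h2.const_mul _), integral_const_mul, integral_const_mul, ← hα] at hn
  linarith

/-- With independent copies M, M' of law ν, twice Cov(M, φ(M)) is E[(M - M')(φ(M) - φ(M'))].
Inserting the expansion of φ and then replacing ψ(min(M, M')) by its target E ψ(M) leaves two
errors. Since |M - M'| ≤ M + M', the remainder contributes at most B E[(M - M')(M² - M'²)] = 2B
Cov(M, M²). The replacement costs at most |a| D E[(M - M')²((M + M')/2 + α)] = |a| D (Cov(M, M²) +
2α Var(M)), which is at most 3|a| D Cov(M, M²) by `mean_mul_variance_le`. Halving gives the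
constant.

The predicate `p` singles out the points where φ and ψ are controlled; in the application these are
the points that make the full index an integer. -/
lemma abs_integral_sub_mean_mul_le {ν : Measure ℝ} [IsProbabilityMeasure ν]
    (h0 : ∀ᵐ m ∂ν, 0 ≤ m) (h3 : Integrable (fun m : ℝ => m ^ 3) ν) {φ ψ : ℝ → ℝ} {K a B D : ℝ}
    (hφ : Measurable φ) (hψ : Measurable ψ) (hφK : ∀ m, |φ m| ≤ K) (hψK : ∀ m, |ψ m| ≤ K)
    (hD : 0 ≤ D) {p : ℝ → Prop} (hp : ∀ᵐ m ∂ν, p m)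
    (htaylor : ∀ m m', p m → p m' →
      |φ m - φ m' - a * (m - m') * ψ (min m m')| ≤ B * (m - m') ^ 2)
    (hlip : ∀ m m', p m → p m' → |ψ m - ψ m'| ≤ D * |m - m'|) :
    |∫ m, (m - ∫ x, x ∂ν) * φ m ∂ν -
        a * (∫ m, m ^ 2 ∂ν - (∫ m, m ∂ν) ^ 2) * ∫ m, ψ m ∂ν| ≤
      (B + 3 / 2 * (|a| * D)) * (∫ m, m ^ 3 ∂ν - (∫ m, m ∂ν) * ∫ m, m ^ 2 ∂ν) := by
  obtain ⟨h1, h2⟩ := integrable_pow_of_integrable_pow_three h3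
  have iφ : Integrable φ ν := Integrable.of_bound hφ.aestronglyMeasurable K (ae_of_all _ hφK)
  have iψ : Integrable ψ ν := Integrable.of_bound hψ.aestronglyMeasurable K (ae_of_all _ hψK)
  have imφ : Integrable (fun m => m * φ m) ν :=
    h1.mul_bdd (c := K) hφ.aestronglyMeasurable (ae_of_all _ hφK)
  have hmcov := mean_mul_variance_le h0 h3
  set α := ∫ m, m ∂ν with hα
  set c₀ := ∫ m, ψ m ∂ν with hc₀
  have i2' : Integrable (fun m : ℝ => m * m) ν := by simpa [pow_two] using h2
  have i3' : Integrable (fun m : ℝ => m * m ^ 2) ν :=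
    h3.congr (ae_of_all _ fun m => by ring)
  have j1 := integrable_prod_sub_mul_sub h1 iφ imφ
  have j2 := integrable_prod_sub_mul_sub h1 h1 i2'
  have j3 := integrable_prod_sub_mul_sub h1 h2 i3'
  have k1 := integral_prod_sub_mul_sub h1 iφ imφ
  have k2 := integral_prod_sub_mul_sub h1 h1 i2'
  have k3 := integral_prod_sub_mul_sub h1 h2 i3'
  have e3 : ∫ m : ℝ, m * m ^ 2 ∂ν = ∫ m, m ^ 3 ∂ν := by congr 1; ext m; ring
  have e2 : ∫ m : ℝ, m * m ∂ν = ∫ m, m ^ 2 ∂ν := by congr 1; ext m; ring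
  rw [e3] at k3
  rw [e2] at k2
  rw [integral_sub_mean_mul iφ imφ, ← hα]
  -- Average the Lipschitz bound over an independent M, using |y - M| ≤ y + M.
  have hψc : ∀ y, 0 ≤ y → p y → |ψ y - c₀| ≤ D * (y + α) := by
    intro y hy hpy
    have e : ψ y - c₀ = ∫ x, (ψ y - ψ x) ∂ν := by
      rw [integral_sub (integrable_const _) iψ]; simp [hc₀]
    have e' : D * (y + α) = ∫ x, D * (y + x) ∂ν := by
      rw [integral_const_mul, integral_add (integrable_const _) h1]; simp [hα]
    rw [e, e', ← Real.norm_eq_abs]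
    refine norm_integral_le_of_norm_le (((integrable_const y).add h1).const_mul D) ?_
    filter_upwards [h0, hp] with x hx hpx
    refine (hlip y x hpy hpx).trans (mul_le_mul_of_nonneg_left ?_ hD)
    rw [abs_le]; constructor <;> linarith
  have hgood : ∀ᵐ z ∂(ν.prod ν), (0 ≤ z.1 ∧ p z.1) ∧ (0 ≤ z.2 ∧ p z.2) := by
    have h := h0.and hp
    exact (Measure.quasiMeasurePreserving_fst.ae h).and (Measure.quasiMeasurePreserving_snd.ae h)
  have main : |∫ z : ℝ × ℝ, ((z.1 - z.2) * (φ z.1 - φ z.2) -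
      (a * c₀) * ((z.1 - z.2) * (z.1 - z.2))) ∂(ν.prod ν)| ≤
      ∫ z : ℝ × ℝ, ((B + |a| * D / 2) * ((z.1 - z.2) * (z.1 ^ 2 - z.2 ^ 2)) +
        (|a| * D * α) * ((z.1 - z.2) * (z.1 - z.2))) ∂(ν.prod ν) := by
    rw [← Real.norm_eq_abs]
    refine norm_integral_le_of_norm_le ((j3.const_mul _).add (j2.const_mul _)) ?_
    filter_upwards [hgood] with z hz
    obtain ⟨⟨hz1, hp1⟩, hz2, hp2⟩ := hz
    generalize z.1 = m at *
    generalize z.2 = m' at *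
    have ht := htaylor m m' hp1 hp2
    have hmin0 : 0 ≤ min m m' := le_min hz1 hz2
    have hminp : p (min m m') := by rcases min_choice m m' with h | h <;> rw [h] <;> assumption
    have hmin2 : min m m' ≤ (m + m') / 2 := by
      have h1 := min_le_left m m'
      have h2 := min_le_right m m'
      linarith
    have hc := hψc _ hmin0 hminp
    have habs : |m - m'| ≤ m + m' := by rw [abs_le]; constructor <;> linarith
    have e : (m - m') * (φ m - φ m') - a * c₀ * ((m - m') * (m - m')) =
        (m - m') * (φ m - φ m' - a * (m - m') * ψ (min m m')) +
          a * (m - m') ^ 2 * (ψ (min m m') - c₀) := by ring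
    rw [e, Real.norm_eq_abs]
    refine (abs_add_le _ _).trans ?_
    rw [abs_mul, abs_mul, abs_mul, abs_of_nonneg (sq_nonneg (m - m'))]
    have t1 : |m - m'| * |φ m - φ m' - a * (m - m') * ψ (min m m')| ≤
        (m + m') * (B * (m - m') ^ 2) :=
      mul_le_mul habs ht (abs_nonneg _) (add_nonneg hz1 hz2)
    have t2 : |a| * (m - m') ^ 2 * |ψ (min m m') - c₀| ≤
        |a| * (m - m') ^ 2 * (D * ((m + m') / 2 + α)) :=
      mul_le_mul_of_nonneg_left (hc.trans (by gcongr)) (by positivity)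
    refine (add_le_add t1 t2).trans (le_of_eq ?_)
    ring
  rw [integral_sub j1 (j2.const_mul _), integral_add (j3.const_mul _) (j2.const_mul _),
    integral_const_mul, integral_const_mul, integral_const_mul, k1, k2, k3, ← hα] at main
  have haD : 0 ≤ |a| * D := by positivity
  have hfin := mul_le_mul_of_nonneg_left hmcov haD
  have hdouble : |∫ m, m * φ m ∂ν - α * ∫ m, φ m ∂ν - a * (∫ m, m ^ 2 ∂ν - α ^ 2) * c₀| =
      |2 * (∫ m, m * φ m ∂ν - α * ∫ m, φ m ∂ν) -
        a * c₀ * (2 * (∫ m, m ^ 2 ∂ν - α * α))| / 2 := by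
    rw [eq_div_iff (by norm_num), ← abs_two (α := ℝ), ← abs_mul, abs_two]
    congr 1; ring
  rw [hdouble]
  linarith

variable {Ω' : Type*} [MeasurableSpace Ω'] {Q : Measure Ω'} [IsProbabilityMeasure Q]
  {g g₁ : ℕ → ℝ} {K a B D : ℝ}

/-- Conditioning on U = u turns this into the one-variable estimate for φ(v) = g(⌊u + v⌋). Neither U
nor V need be integer-valued; only their sum is, almost surely. The floor merely extends g to the
reals, and between admissible v, v' the difference v - v' is a difference of integers. -/
lemma abs_integral_index_summand_le {U V : Ω' → ℝ} (hU : Measurable U) (hV : Measurable V)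
    (hUV : IndepFun U V Q) (hV0 : ∀ᵐ ω ∂Q, 0 ≤ V ω) (hV3 : Integrable (fun ω => V ω ^ 3) Q)
    (hnat : ∀ᵐ ω ∂Q, ∃ k : ℕ, U ω + V ω = k)
    (hgK : ∀ k, |g k| ≤ K) (hg₁K : ∀ k, |g₁ k| ≤ K) (hD : 0 ≤ D)
    (htaylor : ∀ k l : ℕ, |g l - g k - a * ((l : ℝ) - k) * g₁ (min k l)| ≤ B * ((l : ℝ) - k) ^ 2)
    (hlip : ∀ k l : ℕ, |g₁ k - g₁ l| ≤ D * |(k : ℝ) - l|) :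
    |∫ ω, ((V ω - ∫ ω', V ω' ∂Q) * g ⌊U ω + V ω⌋₊ - a * Var[V; Q] * g₁ ⌊U ω + V ω⌋₊) ∂Q| ≤
      (B + 3 / 2 * (|a| * D)) *
        (∫ ω, V ω ^ 3 ∂Q - (∫ ω, V ω ∂Q) * ∫ ω, V ω ^ 2 ∂Q) := by
  have hVm := hV.aemeasurable (μ := Q)
  set ν := Q.map V with hν
  set ρ := Q.map U with hρ
  have : IsProbabilityMeasure ν := Measure.isProbabilityMeasure_map hVm
  have : IsProbabilityMeasure ρ := Measure.isProbabilityMeasure_map hU.aemeasurable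
  have hprod : Q.map (fun ω => (U ω, V ω)) = ρ.prod ν :=
    (indepFun_iff_map_prod_eq_prod_map_map hU.aemeasurable hVm).1 hUV
  have hmeas : Measurable (fun ω => (U ω, V ω)) := hU.prodMk hV
  have hν0 : ∀ᵐ m ∂ν, 0 ≤ m := (ae_map_iff hVm measurableSet_Ici).2 hV0
  have hν3 : Integrable (fun m : ℝ => m ^ 3) ν :=
    (integrable_map_measure (by fun_prop) hVm).2 hV3
  obtain ⟨hν1, hν2⟩ := integrable_pow_of_integrable_pow_three hν3
  have e1 : ∫ ω, V ω ∂Q = ∫ m, m ∂ν :=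
    (integral_map (f := fun m : ℝ => m) hVm (by fun_prop)).symm
  have e2 : ∫ ω, V ω ^ 2 ∂Q = ∫ m, m ^ 2 ∂ν :=
    (integral_map (f := fun m : ℝ => m ^ 2) hVm (by fun_prop)).symm
  have e3 : ∫ ω, V ω ^ 3 ∂Q = ∫ m, m ^ 3 ∂ν :=
    (integral_map (f := fun m : ℝ => m ^ 3) hVm (by fun_prop)).symm
  have hV2 : MemLp V 2 Q := by
    refine (memLp_two_iff_integrable_sq hV.aestronglyMeasurable).2 ?_
    exact (integrable_map_measure (f := V) (g := fun m : ℝ => m ^ 2) (by fun_prop) hVm).1 hν2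
  have evar : Var[V; Q] = ∫ m, m ^ 2 ∂ν - (∫ m, m ∂ν) ^ 2 := by
    rw [variance_eq_sub hV2, ← e1, ← e2]; rfl
  rw [evar, e1, e2, e3]
  have hmg : ∀ u : ℕ → ℝ, Measurable (fun z : ℝ × ℝ => u ⌊z.1 + z.2⌋₊) := fun u =>
    (measurable_from_nat (f := u)).comp (Nat.measurable_floor.comp (by fun_prop))
  set T : ℝ × ℝ → ℝ := fun z => (z.2 - ∫ m, m ∂ν) * g ⌊z.1 + z.2⌋₊ -
    a * (∫ m, m ^ 2 ∂ν - (∫ m, m ∂ν) ^ 2) * g₁ ⌊z.1 + z.2⌋₊ with hT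
  have hTm : Measurable T := by
    have := hmg g
    have := hmg g₁
    fun_prop
  have eT : ∫ ω, ((V ω - ∫ m, m ∂ν) * g ⌊U ω + V ω⌋₊ -
      a * (∫ m, m ^ 2 ∂ν - (∫ m, m ∂ν) ^ 2) * g₁ ⌊U ω + V ω⌋₊) ∂Q = ∫ z, T z ∂(ρ.prod ν) := by
    rw [← hprod, integral_map hmeas.aemeasurable hTm.aestronglyMeasurable]
  have i1 : Integrable (fun z : ℝ × ℝ => (z.2 - ∫ m, m ∂ν) * g ⌊z.1 + z.2⌋₊) (ρ.prod ν) :=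
    ((hν1.comp_snd ρ).sub (integrable_const _)).mul_bdd (c := K) (hmg g).aestronglyMeasurable
      (ae_of_all _ fun z => hgK _)
  have i2 : Integrable (fun z : ℝ × ℝ => a * (∫ m, m ^ 2 ∂ν - (∫ m, m ∂ν) ^ 2) *
      g₁ ⌊z.1 + z.2⌋₊) (ρ.prod ν) :=
    (Integrable.of_bound (hmg g₁).aestronglyMeasurable K (ae_of_all _ fun z => hg₁K _)).const_mul _
  have hTi : Integrable T (ρ.prod ν) := i1.sub i2
  have hnat' : ∀ᵐ u ∂ρ, ∀ᵐ v ∂ν, ∃ k : ℕ, u + v = (k : ℝ) := by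
    have hms : MeasurableSet {z : ℝ × ℝ | ∃ k : ℕ, z.1 + z.2 = (k : ℝ)} := by
      have h := (countable_range (fun k : ℕ => (k : ℝ))).measurableSet.preimage
        (measurable_fst.add measurable_snd : Measurable fun z : ℝ × ℝ => z.1 + z.2)
      convert h using 1
      ext z
      simp [eq_comm]
    have : ∀ᵐ z ∂(ρ.prod ν), ∃ k : ℕ, z.1 + z.2 = (k : ℝ) := by
      rw [← hprod]
      exact (ae_map_iff hmeas.aemeasurable hms).2 hnat
    exact Measure.ae_ae_of_ae_prod this
  rw [eT, integral_prod _ hTi, ← Real.norm_eq_abs]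
  set C := (B + 3 / 2 * (|a| * D)) * (∫ m, m ^ 3 ∂ν - (∫ m, m ∂ν) * ∫ m, m ^ 2 ∂ν)
  have hC : ∀ᵐ u ∂ρ, ‖∫ v, T (u, v) ∂ν‖ ≤ C := by
    filter_upwards [hnat'] with u hu
    have hmu : ∀ w : ℕ → ℝ, Measurable (fun v : ℝ => w ⌊u + v⌋₊) := fun w =>
      (hmg w).comp measurable_prodMk_left
    have key := abs_integral_sub_mean_mul_le (φ := fun v => g ⌊u + v⌋₊)
      (ψ := fun v => g₁ ⌊u + v⌋₊) (a := a) (B := B) (p := fun v => ∃ k : ℕ, u + v = (k : ℝ)) hν0 hν3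
      (hmu g) (hmu g₁) (fun _ => hgK _) (fun _ => hg₁K _) hD hu ?_ ?_
    · simp only [hT]
      rw [integral_sub, integral_const_mul]
      · exact key
      · exact (hν1.sub (integrable_const _)).mul_bdd (c := K) (hmu g).aestronglyMeasurable
          (ae_of_all _ fun z => hgK _)
      · exact (Integrable.of_bound (hmu g₁).aestronglyMeasurable K
          (ae_of_all _ fun z => hg₁K _)).const_mul _
    · rintro m m' ⟨k, hk⟩ ⟨k', hk'⟩
      have h1 : m - m' = (k : ℝ) - k' := by linarith
      have h2 : u + min m m' = ((min k' k : ℕ) : ℝ) := by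
        rw [← min_add_add_left, hk, hk', Nat.cast_min, min_comm]
      simp only [hk, hk', h1, h2, Nat.floor_natCast]
      exact htaylor k' k
    · rintro m m' ⟨k, hk⟩ ⟨k', hk'⟩
      have h1 : m - m' = (k : ℝ) - k' := by linarith
      simp only [hk, hk', h1, Nat.floor_natCast]
      exact hlip k k'
  simpa using norm_integral_le_of_norm_le_const hC

/-- Stein's identity for an index that is a sum of i.i.d. nonnegative random variables. -/
lemma abs_integral_index_sum_le {n : ℕ} (hn : 0 < n) {M : Fin n → Ω' → ℝ}
    (hM : ∀ j, Measurable (M j)) (hMindep : iIndepFun M Q)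
    (hMident : ∀ j, IdentDistrib (M j) (M ⟨0, hn⟩) Q Q) (hM0 : ∀ j, ∀ᵐ ω ∂Q, 0 ≤ M j ω)
    (hM3 : Integrable (fun ω => M ⟨0, hn⟩ ω ^ 3) Q)
    (hnat : ∀ᵐ ω ∂Q, ∃ k : ℕ, ∑ j, M j ω = k)
    (hgK : ∀ k, |g k| ≤ K) (hg₁K : ∀ k, |g₁ k| ≤ K) (hD : 0 ≤ D)
    (htaylor : ∀ k l : ℕ, |g l - g k - a * ((l : ℝ) - k) * g₁ (min k l)| ≤ B * ((l : ℝ) - k) ^ 2)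
    (hlip : ∀ k l : ℕ, |g₁ k - g₁ l| ≤ D * |(k : ℝ) - l|) :
    |∫ ω, ((∑ j, M j ω - n * ∫ ω', M ⟨0, hn⟩ ω' ∂Q) * g ⌊∑ j, M j ω⌋₊ -
        n * (a * Var[M ⟨0, hn⟩; Q]) * g₁ ⌊∑ j, M j ω⌋₊) ∂Q| ≤
      n * ((B + 3 / 2 * (|a| * D)) * (∫ ω, M ⟨0, hn⟩ ω ^ 3 ∂Q -
        (∫ ω, M ⟨0, hn⟩ ω ∂Q) * ∫ ω, M ⟨0, hn⟩ ω ^ 2 ∂Q)) := by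
  have hpow : ∀ (i : Fin n) (q : ℕ), IdentDistrib (fun ω => M i ω ^ q)
      (fun ω => M ⟨0, hn⟩ ω ^ q) Q Q := fun i q =>
    (hMident i).comp (u := fun x => x ^ q) (by fun_prop)
  have hS : Measurable (fun ω => ∑ j, M j ω) := Finset.measurable_fun_sum _ fun j _ => hM j
  have hm : ∀ u : ℕ → ℝ, Measurable (fun ω => u ⌊∑ j, M j ω⌋₊) := fun u =>
    (measurable_from_nat (f := u)).comp (Nat.measurable_floor.comp hS)
  have hM1 : ∀ i, Integrable (M i) Q := fun i => by
    refine (hMident i).symm.integrable_snd ?_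
    have := integrable_abs_pow_three_iff (P := Q) (hM ⟨0, hn⟩).aestronglyMeasurable
    refine (this.1 ?_).integrable (by norm_num)
    simpa [abs_pow] using hM3.abs
  have hint : ∀ i, Integrable (fun ω => (M i ω - ∫ ω', M i ω' ∂Q) * g ⌊∑ j, M j ω⌋₊ -
      a * Var[M i; Q] * g₁ ⌊∑ j, M j ω⌋₊) Q := fun i => by
    refine Integrable.sub ?_ ?_
    · exact ((hM1 i).sub (integrable_const _)).mul_bdd (c := K) (hm g).aestronglyMeasurable
        (ae_of_all _ fun z => hgK _)
    · exact (Integrable.of_bound (hm g₁).aestronglyMeasurable K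
        (ae_of_all _ fun z => hg₁K _)).const_mul _
  -- Both the centred index and its variance are sums over the i.i.d. components, so each component
  -- is compared separately, with the others in the role of U.
  have e : ∀ ω, (∑ j, M j ω - n * ∫ ω', M ⟨0, hn⟩ ω' ∂Q) * g ⌊∑ j, M j ω⌋₊ -
        n * (a * Var[M ⟨0, hn⟩; Q]) * g₁ ⌊∑ j, M j ω⌋₊ =
      ∑ i, ((M i ω - ∫ ω', M i ω' ∂Q) * g ⌊∑ j, M j ω⌋₊ -
        a * Var[M i; Q] * g₁ ⌊∑ j, M j ω⌋₊) := fun ω => by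
    simp_rw [fun i => (hMident i).integral_eq, fun i => (hMident i).variance_eq,
      Finset.sum_sub_distrib, ← Finset.sum_mul, Finset.sum_sub_distrib]
    simp [mul_assoc]
  simp_rw [e]
  rw [integral_finsetSum _ fun i _ => hint i]
  refine (Finset.abs_sum_le_sum_abs _ _).trans ?_
  refine (Finset.sum_le_sum (g := fun _ => (B + 3 / 2 * (|a| * D)) *
    (∫ ω, M ⟨0, hn⟩ ω ^ 3 ∂Q - (∫ ω, M ⟨0, hn⟩ ω ∂Q) * ∫ ω, M ⟨0, hn⟩ ω ^ 2 ∂Q))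
    fun i _ => ?_).trans (le_of_eq ?_)
  · have hUm : Measurable (fun ω => ∑ j ∈ Finset.univ.erase i, M j ω) :=
      Finset.measurable_fun_sum _ fun j _ => hM j
    have hind : IndepFun (fun ω => ∑ j ∈ Finset.univ.erase i, M j ω) (M i) Q := by
      have := hMindep.indepFun_finsetSum_of_notMem hM (Finset.notMem_erase i Finset.univ)
      convert this using 1
      ext ω; simp
    have hs : ∀ ω, ∑ j ∈ Finset.univ.erase i, M j ω + M i ω = ∑ j, M j ω := fun ω =>
      Finset.sum_erase_add _ _ (Finset.mem_univ i)
    have key := abs_integral_index_summand_le (a := a) hUm (hM i) hind (hM0 i)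
      ((hpow i 3).symm.integrable_snd hM3) (by simp_rw [hs]; exact hnat) hgK hg₁K hD htaylor hlip
    simp_rw [hs] at key
    have hi1 : ∫ ω, M i ω ∂Q = ∫ ω, M ⟨0, hn⟩ ω ∂Q := (hMident i).integral_eq
    rw [(hpow i 3).integral_eq, (hpow i 2).integral_eq, hi1] at key
    rw [hi1]
    exact key
  · simp

end Index

/-! ### Random sums -/

section RandomSum

variable {Ω : Type*} [MeasurableSpace Ω] {P : Measure Ω} [IsProbabilityMeasure P]
  {N : Ω → ℕ} {X : ℕ → Ω → ℝ}

/-- Fubini's theorem for an index that is independent of the summands. -/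
lemma integral_randomIndex (hN : Measurable N) (hX : ∀ j, Measurable (X j))
    (hNX : IndepFun N (fun ω j => X j ω) P) {H : ℕ → (ℕ → ℝ) → ℝ} (hH : ∀ k, Measurable (H k))
    {u : ℕ → ℝ} (hHi : ∀ k, Integrable (fun ω => H k (fun j => X j ω)) P)
    (hHu : ∀ k, ∫ ω, |H k (fun j => X j ω)| ∂P ≤ u k) (hu : Integrable (fun ω => u (N ω)) P) :
    Integrable (fun ω => H (N ω) (fun j => X j ω)) P ∧
    ∫ ω, H (N ω) (fun j => X j ω) ∂P = ∫ ω, ∫ ω', H (N ω) (fun j => X j ω') ∂P ∂P := by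
  have hξ : Measurable (fun ω j => X j ω) := measurable_pi_lambda _ hX
  set ξ : Ω → ℕ → ℝ := fun ω j => X j ω with hξ_def
  have hmeas : Measurable (fun ω => (N ω, ξ ω)) := hN.prodMk hξ
  have hprod : P.map (fun ω => (N ω, ξ ω)) = (P.map N).prod (P.map ξ) :=
    (indepFun_iff_map_prod_eq_prod_map_map hN.aemeasurable hξ.aemeasurable).1 hNX
  have hTm : Measurable (fun z : ℕ × (ℕ → ℝ) => H z.1 z.2) :=
    measurable_from_prod_countable_right hH
  have : IsProbabilityMeasure (P.map N) := Measure.isProbabilityMeasure_map hN.aemeasurable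
  have : IsProbabilityMeasure (P.map ξ) := Measure.isProbabilityMeasure_map hξ.aemeasurable
  have hint : Integrable (fun z : ℕ × (ℕ → ℝ) => H z.1 z.2) ((P.map N).prod (P.map ξ)) := by
    rw [integrable_prod_iff hTm.aestronglyMeasurable]
    constructor
    · refine ae_of_all _ fun k => ?_
      exact (integrable_map_measure (hH k).aestronglyMeasurable hξ.aemeasurable).2 (hHi k)
    · refine (integrable_map_measure (measurable_from_nat).aestronglyMeasurable
        hN.aemeasurable).2 ?_
      refine hu.mono (measurable_from_nat.comp hN).aestronglyMeasurable (ae_of_all _ fun ω => ?_)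
      have e : ∫ y, ‖H (N ω) y‖ ∂(P.map ξ) = ∫ ω', |H (N ω) (ξ ω')| ∂P :=
        integral_map hξ.aemeasurable (hH _).norm.aestronglyMeasurable
      simp only [Function.comp_apply]
      rw [e, Real.norm_of_nonneg (integral_nonneg fun _ => abs_nonneg _)]
      exact (hHu _).trans (le_abs_self _)
  constructor
  · rw [← hprod] at hint
    exact (integrable_map_measure hTm.aestronglyMeasurable hmeas.aemeasurable).1 hint
  · calc ∫ ω, H (N ω) (ξ ω) ∂P = ∫ z, H z.1 z.2 ∂(P.map fun ω => (N ω, ξ ω)) :=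
          (integral_map (f := fun z : ℕ × (ℕ → ℝ) => H z.1 z.2) hmeas.aemeasurable
            hTm.aestronglyMeasurable).symm
      _ = ∫ k, ∫ y, H k y ∂(P.map ξ) ∂(P.map N) := by rw [hprod, integral_prod _ hint]
      _ = ∫ ω, ∫ y, H (N ω) y ∂(P.map ξ) ∂P :=
          integral_map hN.aemeasurable (measurable_from_nat).aestronglyMeasurable
      _ = _ := by
          congr 1; ext ω
          exact integral_map hξ.aemeasurable (hH _).aestronglyMeasurable

lemma integral_abs_partialSum_le (hXident : ∀ j, IdentDistrib (X j) (X 0) P P)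
    (hX3 : MemLp (X 0) 3 P) (k : ℕ) :
    ∫ ω, |∑ j ∈ Finset.range k, X j ω| ∂P ≤ k * √(∫ ω, X 0 ω ^ 2 ∂P) := by
  simpa using integral_abs_sum_Ico_le hXident hX3 0 k (Nat.zero_le k)

lemma memLp_two_partialSum (hXident : ∀ j, IdentDistrib (X j) (X 0) P P)
    (hX3 : MemLp (X 0) 3 P) (k : ℕ) : MemLp (fun ω => ∑ j ∈ Finset.range k, X j ω) 2 P :=
  memLp_finsetSum _ fun j _ =>
    (memLp_of_identDistrib hX3 hXident j).mono_exponent (by norm_num)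

lemma integral_partialSum (hXident : ∀ j, IdentDistrib (X j) (X 0) P P)
    (hX3 : MemLp (X 0) 3 P) (k : ℕ) :
    ∫ ω, ∑ j ∈ Finset.range k, X j ω ∂P = k * ∫ ω, X 0 ω ∂P := by
  rw [integral_finsetSum _ fun j _ =>
    (memLp_of_identDistrib hX3 hXident j).integrable (by norm_num)]
  simp [fun j => (hXident j).integral_eq]

lemma integral_partialSum_sq (hXindep : iIndepFun X P)
    (hXident : ∀ j, IdentDistrib (X j) (X 0) P P) (hX3 : MemLp (X 0) 3 P) (k : ℕ) :
    ∫ ω, (∑ j ∈ Finset.range k, X j ω) ^ 2 ∂P =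
      k * Var[X 0; P] + (k : ℝ) ^ 2 * (∫ ω, X 0 ω ∂P) ^ 2 := by
  have hv : Var[fun ω => ∑ j ∈ Finset.range k, X j ω; P] = k * Var[X 0; P] := by
    have h := IndepFun.variance_sum (μ := P) (X := X) (s := Finset.range k) (fun j _ =>
      (memLp_of_identDistrib hX3 hXident j).mono_exponent (by norm_num))
      (fun i _ j _ hij => hXindep.indepFun hij)
    simp only [fun j => (hXident j).variance_eq, Finset.sum_const, Finset.card_range,
      nsmul_eq_mul] at h
    rw [← h]
    congr 1
    ext ω; simp
  rw [variance_eq_sub (memLp_two_partialSum hXident hX3 k), integral_partialSum hXident hX3] at hv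
  simp only [Pi.pow_apply] at hv
  linarith

/-- Wald's identities: integrate the first two moments of S_k against the law of N. -/
lemma memLp_randomSum (hN : Measurable N) (hX : ∀ j, Measurable (X j))
    (hXindep : iIndepFun X P) (hNX : IndepFun N (fun ω j => X j ω) P)
    (hXident : ∀ j, IdentDistrib (X j) (X 0) P P) (hX3 : MemLp (X 0) 3 P)
    (hN2 : MemLp (fun ω => (N ω : ℝ)) 2 P) :
    MemLp (randomSum N X) 2 P ∧
    ∫ ω, randomSum N X ω ∂P = (∫ ω, (N ω : ℝ) ∂P) * ∫ ω, X 0 ω ∂P ∧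
    Var[randomSum N X; P] = Var[X 0; P] * ∫ ω, (N ω : ℝ) ∂P +
      (∫ ω, X 0 ω ∂P) ^ 2 * Var[fun ω => (N ω : ℝ); P] := by
  have hN1 : Integrable (fun ω => (N ω : ℝ)) P := hN2.integrable (by norm_num)
  have hm : ∀ k : ℕ, Measurable (fun x : ℕ → ℝ => ∑ j ∈ Finset.range k, x j) := fun k => by
    fun_prop
  have h1 := integral_randomIndex hN hX hNX (H := fun k x => ∑ j ∈ Finset.range k, x j)
    (u := fun k => k * √(∫ ω, X 0 ω ^ 2 ∂P)) hm
    (fun k => (memLp_two_partialSum hXident hX3 k).integrable (by norm_num))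
    (integral_abs_partialSum_le hXident hX3) (hN1.mul_const _)
  have h2 := integral_randomIndex hN hX hNX (H := fun k x => (∑ j ∈ Finset.range k, x j) ^ 2)
    (u := fun k => k * Var[X 0; P] + (k : ℝ) ^ 2 * (∫ ω, X 0 ω ∂P) ^ 2) (fun k => (hm k).pow_const 2)
    (fun k => (memLp_two_partialSum hXident hX3 k).integrable_sq)
    (fun k => by
      simp only [abs_pow, sq_abs]
      exact (integral_partialSum_sq hXindep hXident hX3 k).le)
    ((hN1.mul_const _).add (hN2.integrable_sq.mul_const _))
  simp only [integral_partialSum hXident hX3, integral_partialSum_sq hXindep hXident hX3] at h1 h2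
  rw [integral_mul_const] at h1
  rw [integral_add (hN1.mul_const _) (hN2.integrable_sq.mul_const _), integral_mul_const,
    integral_mul_const] at h2
  have hS2 : MemLp (randomSum N X) 2 P :=
    (memLp_two_iff_integrable_sq h1.1.aestronglyMeasurable).2 h2.1
  refine ⟨hS2, h1.2, ?_⟩
  rw [variance_eq_sub hS2, variance_eq_sub hN2]
  have e1 : ∫ ω, randomSum N X ω ∂P = _ := h1.2
  have e2 : ∫ ω, randomSum N X ω ^ 2 ∂P = _ := h2.2
  simp only [Pi.pow_apply]
  rw [e1, e2]
  ring

/-- Stein's identity for a random sum, given an approximate Stein identity for its index. -/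
lemma abs_integral_randomSum_le {F F' : ℝ → ℝ} {K L : ℝ} (hF : IsTestFun F F' K L)
    (hN : Measurable N) (hX : ∀ j, Measurable (X j))
    (hXindep : iIndepFun X P) (hNX : IndepFun N (fun ω j => X j ω) P)
    (hXident : ∀ j, IdentDistrib (X j) (X 0) P P) (hX3 : MemLp (X 0) 3 P)
    (hN2 : MemLp (fun ω => (N ω : ℝ)) 2 P) {a α C : ℝ} (ha : a = ∫ ω, X 0 ω ∂P)
    (hα : α = ∫ ω, (N ω : ℝ) ∂P)
    (hC : |∫ ω, (((N ω : ℝ) - α) * ∫ ω', F (∑ j ∈ Finset.range (N ω), X j ω') ∂P -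
      a * Var[fun ω => (N ω : ℝ); P] * ∫ ω', F' (∑ j ∈ Finset.range (N ω), X j ω') ∂P) ∂P| ≤ C) :
    |∫ ω, (randomSum N X ω - a * α) * F (randomSum N X ω) ∂P -
        Var[randomSum N X; P] * ∫ ω, F' (randomSum N X ω) ∂P| ≤
      3 * L / 2 * α * ∫ ω, |X 0 ω - a| ^ 3 ∂P +
      Var[X 0; P] * (L * √(∫ ω, X 0 ω ^ 2 ∂P) * Var[fun ω => (N ω : ℝ); P]) + |a| * C := by
  have hN1 : Integrable (fun ω => (N ω : ℝ)) P := hN2.integrable (by norm_num)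
  set g : ℕ → ℝ := fun k => ∫ ω', F (∑ j ∈ Finset.range k, X j ω') ∂P with hg
  set g₁ : ℕ → ℝ := fun k => ∫ ω', F' (∑ j ∈ Finset.range k, X j ω') ∂P with hg₁
  set A : ℕ → ℝ := fun k =>
    ∫ ω, (∑ j ∈ Finset.range k, X j ω - k * a) * F (∑ j ∈ Finset.range k, X j ω) ∂P with hA
  set b := √(∫ ω, X 0 ω ^ 2 ∂P) with hb
  have hS := measurable_partialSum hX
  have hSi : ∀ k, Integrable (fun ω => ∑ j ∈ Finset.range k, X j ω) P := fun k =>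
    (memLp_two_partialSum hXident hX3 k).integrable (by norm_num)
  have hSc : ∀ (k : ℕ) (c : ℝ), Integrable (fun ω => ∑ j ∈ Finset.range k, X j ω - c) P :=
    fun k c => (hSi k).sub (integrable_const c)
  have hm : ∀ k : ℕ, Measurable (fun x : ℕ → ℝ => ∑ j ∈ Finset.range k, x j) := fun k => by
    fun_prop
  have hmN : ∀ u : ℕ → ℝ, AEStronglyMeasurable (fun ω => u (N ω)) P := fun u =>
    ((measurable_from_nat (f := u)).comp hN).aestronglyMeasurable
  have hFm := hF.continuous.measurable
  have hF'm := hF.continuous_deriv.measurable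
  have hK : 0 ≤ K := (abs_nonneg _).trans (hF.bdd 0)
  have h1 := (integral_randomIndex hN hX hNX (H := fun k x => F' (∑ j ∈ Finset.range k, x j))
    (u := fun _ => K) (fun k => hF'm.comp (hm k))
    (fun k => hF.integrable_deriv_comp (hS k)) (fun k => by
      refine (integral_mono (hF.integrable_deriv_comp (hS k)).abs (integrable_const K)
        fun ω => hF.bdd_deriv _).trans ?_
      simp) (integrable_const K)).2
  -- Separates the fluctuation of the summands, S_k - ka, from that of the index, a(k - α).
  have hsplit : ∀ k : ℕ, ∫ ω, (∑ j ∈ Finset.range k, X j ω - a * α) *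
      F (∑ j ∈ Finset.range k, X j ω) ∂P = A k + a * ((k - α) * g k) := by
    intro k
    have e : (fun ω => (∑ j ∈ Finset.range k, X j ω - a * α) * F (∑ j ∈ Finset.range k, X j ω)) =
        fun ω => (∑ j ∈ Finset.range k, X j ω - k * a) * F (∑ j ∈ Finset.range k, X j ω) +
          (a * (k - α)) * F (∑ j ∈ Finset.range k, X j ω) := by ext ω; ring
    rw [e, integral_add (hF.integrable_mul_comp (hSc k _) (hS k))
      ((hF.integrable_comp (hS k)).const_mul _), integral_const_mul, mul_assoc a]
  have h2 := (integral_randomIndex hN hX hNX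
    (H := fun k x => (∑ j ∈ Finset.range k, x j - a * α) * F (∑ j ∈ Finset.range k, x j))
    (u := fun k => (k * b + |a * α|) * K) (fun k => ((hm k).sub_const _).mul (hFm.comp (hm k)))
    (fun k => hF.integrable_mul_comp (hSc k _) (hS k)) (fun k => by
      have hd : Integrable (fun ω => (|∑ j ∈ Finset.range k, X j ω| + |a * α|) * K) P :=
        ((hSi k).abs.add (integrable_const _)).mul_const K
      refine (integral_mono (hF.integrable_mul_comp (hSc k _) (hS k)).abs
        hd fun ω => ?_).trans ?_
      · simp only [abs_mul]
        exact mul_le_mul ((abs_sub _ _).trans (by rw [abs_mul])) (hF.bdd _) (abs_nonneg _)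
          (by positivity)
      · rw [integral_mul_const, integral_add (hSi k).abs (integrable_const _)]
        refine mul_le_mul_of_nonneg_right ?_ hK
        simpa using integral_abs_partialSum_le hXident hX3 k)
    (((hN1.mul_const _).add (integrable_const _)).mul_const _)).2
  simp only [hsplit] at h2
  have hSdef : ∀ ω, randomSum N X ω = ∑ j ∈ Finset.range (N ω), X j ω := fun _ => rfl
  simp only [hSdef]
  rw [h1, h2]
  obtain ⟨-, -, hvar⟩ := memLp_randomSum hN hX hXindep hNX hXident hX3 hN2
  have hvar' : Var[fun ω => ∑ j ∈ Finset.range (N ω), X j ω; P] =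
    Var[X 0; P] * α + a ^ 2 * Var[fun ω => (N ω : ℝ); P] := by rw [hα, ha]; exact hvar
  rw [show Var[randomSum N X; P] = _ from hvar']
  change |∫ ω, (A (N ω) + a * (((N ω : ℝ) - α) * g (N ω))) ∂P - (Var[X 0; P] * α +
    a ^ 2 * Var[fun ω => (N ω : ℝ); P]) * ∫ ω, g₁ (N ω) ∂P| ≤ _
  have ig₁ : Integrable (fun ω => g₁ (N ω)) P :=
    Integrable.of_bound (hmN g₁) K (ae_of_all _ fun _ => hF.abs_integral_deriv_comp_le)
  have iNg : Integrable (fun ω => ((N ω : ℝ) - α) * g (N ω)) P :=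
    (hN1.sub (integrable_const α)).mul_bdd (c := K) (hmN g)
      (ae_of_all _ fun _ => hF.abs_integral_comp_le)
  have iNg₁ : Integrable (fun ω => (N ω : ℝ) * g₁ (N ω)) P :=
    hN1.mul_bdd (c := K) (hmN g₁) (ae_of_all _ fun _ => hF.abs_integral_deriv_comp_le)
  set D₃ := ∫ ω, |X 0 ω - a| ^ 3 ∂P with hD₃
  set V := Var[X 0; P] with hV
  set VN := Var[fun ω => (N ω : ℝ); P] with hVN
  have hR : ∀ k : ℕ, |A k - k * V * g₁ k| ≤ k * (3 * L / 2 * D₃) := fun k =>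
    abs_integral_partialSum_mul_comp_le hF hX hXindep hXident hX3 ha k
  have iR : Integrable (fun ω => A (N ω) - N ω * V * g₁ (N ω)) P :=
    (hN1.mul_const _).mono' (hmN fun k => A k - k * V * g₁ k) (ae_of_all _ fun ω => hR (N ω))
  have iA : Integrable (fun ω => A (N ω)) P := by
    refine (iR.add (iNg₁.const_mul V)).congr (ae_of_all _ fun ω => ?_)
    simp only [Pi.add_apply]; ring
  have t1 : |∫ ω, (A (N ω) - N ω * V * g₁ (N ω)) ∂P| ≤ 3 * L / 2 * α * D₃ := by
    rw [← Real.norm_eq_abs]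
    refine (norm_integral_le_of_norm_le (hN1.mul_const (3 * L / 2 * D₃))
      (ae_of_all _ fun ω => hR (N ω))).trans (le_of_eq ?_)
    rw [integral_mul_const, ← hα]; ring
  -- This is Cov(N, g₁(N)); over two independent copies the Lipschitz bound on g₁ turns it into a
  -- multiple of Var(N).
  have t2 : |∫ ω, (N ω : ℝ) * g₁ (N ω) ∂P - α * ∫ ω, g₁ (N ω) ∂P| ≤ L * b * VN := by
    have hNN : Integrable (fun ω => (N ω : ℝ) * N ω) P := by
      simpa [pow_two] using hN2.integrable_sq
    have k1 := integral_prod_sub_mul_sub hN1 ig₁ iNg₁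
    have k2 := integral_prod_sub_mul_sub hN1 hN1 hNN
    have j2 := integrable_prod_sub_mul_sub hN1 hN1 hNN
    have eVN : VN = ∫ ω, (N ω : ℝ) * N ω ∂P - (∫ ω, (N ω : ℝ) ∂P) * ∫ ω, (N ω : ℝ) ∂P := by
      rw [hVN, variance_eq_sub hN2]; simp [pow_two]
    rw [← eVN] at k2
    rw [← hα] at k1
    have hle : |∫ z : Ω × Ω, ((N z.1 : ℝ) - N z.2) * (g₁ (N z.1) - g₁ (N z.2)) ∂(P.prod P)| ≤
        ∫ z : Ω × Ω, L * b * (((N z.1 : ℝ) - N z.2) * ((N z.1 : ℝ) - N z.2)) ∂(P.prod P) := by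
      rw [← Real.norm_eq_abs]
      refine norm_integral_le_of_norm_le (j2.const_mul _) (ae_of_all _ fun z => ?_)
      have := abs_integral_deriv_partialSum_sub_le hF hX hXident hX3 (N z.1) (N z.2)
      rw [norm_mul, Real.norm_eq_abs, Real.norm_eq_abs]
      calc _ ≤ |(N z.1 : ℝ) - N z.2| * (L * b * |(N z.1 : ℝ) - N z.2|) := by gcongr
        _ = L * b * (|(N z.1 : ℝ) - N z.2| * |(N z.1 : ℝ) - N z.2|) := by ring
        _ = _ := by rw [abs_mul_abs_self]
    rw [integral_const_mul, k1, k2, abs_mul, abs_two] at hle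
    linarith
  have hVN0 : 0 ≤ V := variance_nonneg _ _
  have t3 : |a * ∫ ω, (((N ω : ℝ) - α) * g (N ω) - a * VN * g₁ (N ω)) ∂P| ≤ |a| * C := by
    rw [abs_mul]
    exact mul_le_mul_of_nonneg_left hC (abs_nonneg a)
  have t2' : |V * (∫ ω, (N ω : ℝ) * g₁ (N ω) ∂P - α * ∫ ω, g₁ (N ω) ∂P)| ≤ V * (L * b * VN) := by
    rw [abs_mul, abs_of_nonneg hVN0]
    exact mul_le_mul_of_nonneg_left t2 hVN0
  rw [integral_sub iNg (ig₁.const_mul _), integral_const_mul] at t3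
  have e1 : ∫ ω, (A (N ω) - N ω * V * g₁ (N ω)) ∂P =
      ∫ ω, A (N ω) ∂P - V * ∫ ω, (N ω : ℝ) * g₁ (N ω) ∂P := by
    rw [← integral_const_mul, ← integral_sub iA (iNg₁.const_mul V)]
    congr 1; ext ω; ring
  rw [e1] at t1
  rw [integral_add iA (iNg.const_mul a), integral_const_mul]
  -- As Var(S) = V α + a² VN, the three errors add up to the total exactly: the terms V N g₁(N)
  -- cancel between the first two.
  refine (le_of_eq ?_).trans ((abs_add_three _ _ _).trans (add_le_add (add_le_add t1 t2') t3))
  congr 1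
  ring

end RandomSum

/-! ### The Wasserstein bound -/

/-- K + K/s is just a common bound for the function and its derivative; it serves integrability
only, so its size is irrelevant. -/
lemma IsTestFun.comp_standardize {f f' : ℝ → ℝ} {K L : ℝ} (hf : IsTestFun f f' K L) {s : ℝ}
    (hs : 0 < s) (m : ℝ) :
    IsTestFun (fun y => f ((y - m) / s)) (fun y => f' ((y - m) / s) / s) (K + K / s) (L / s ^ 2) := by
  have hK : 0 ≤ K := (abs_nonneg _).trans (hf.bdd 0)
  refine ⟨fun x => ?_, fun x y => ?_, fun x => ?_, fun x => ?_⟩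
  · have h1 : HasDerivAt (fun y : ℝ => (y - m) / s) (1 / s) x :=
      ((hasDerivAt_id' x).sub_const m).div_const s
    exact ((hf.hasDerivAt ((x - m) / s)).comp x h1).congr_deriv (by ring)
  · rw [← sub_div, abs_div, abs_of_pos hs, div_le_iff₀ hs]
    refine (hf.lip _ _).trans (le_of_eq ?_)
    rw [← sub_div, sub_sub_sub_cancel_right, abs_div, abs_of_pos hs]
    field_simp
  · exact (hf.bdd _).trans (le_add_of_nonneg_right (by positivity))
  · rw [abs_div, abs_of_pos hs]
    exact (div_le_div_of_nonneg_right (hf.bdd_deriv _) hs.le).trans (le_add_of_nonneg_left hK)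

/-- A Wasserstein bound from approximate Stein identities for all test functions. -/
lemma wassersteinDist_normalized_le {Ω : Type*} [MeasurableSpace Ω] {P : Measure Ω}
    [IsProbabilityMeasure P] {S : Ω → ℝ} (hS : MemLp S 2 P) (hSm : Measurable S)
    (hvar : 0 < Var[S; P]) {ε : ℝ}
    (h : ∀ (F F' : ℝ → ℝ) (K : ℝ), IsTestFun F F' K (2 / Var[S; P]) →
      |∫ ω, (S ω - ∫ ω', S ω' ∂P) * F (S ω) ∂P - Var[S; P] * ∫ ω, F' (S ω) ∂P| ≤ √(Var[S; P]) * ε) :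
    wassersteinDist (P.map (normalized P S)) (gaussianReal 0 1) ≤ ENNReal.ofReal ε := by
  refine iSup₂_le fun u hu => ENNReal.ofReal_le_ofReal ?_
  obtain ⟨f, f', K, hd, hlip, hK, hK', hstein⟩ := exists_stein_solution hu
  set s := √(Var[S; P]) with hs_def
  have hs : 0 < s := Real.sqrt_pos.2 hvar
  have hs2 : s ^ 2 = Var[S; P] := Real.sq_sqrt hvar.le
  have hf : IsTestFun f f' K 2 := ⟨hd, hlip, hK, hK'⟩
  have hW : Measurable (normalized P S) := (hSm.sub_const _).div_const _
  have hWi : Integrable (normalized P S) P :=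
    ((hS.integrable (by norm_num)).sub (integrable_const _)).div_const _
  -- For this F the hypothesis reads s |E[W f(W)] - E f'(W)| ≤ s ε, where W is the normalized S.
  have key := h _ _ _ (hs2 ▸ hf.comp_standardize hs (∫ ω', S ω' ∂P))
  have e1 : ∫ ω, (S ω - ∫ ω', S ω' ∂P) * f ((S ω - ∫ ω', S ω' ∂P) / s) ∂P =
      s * ∫ ω, normalized P S ω * f (normalized P S ω) ∂P := by
    rw [← integral_const_mul]
    refine integral_congr_ae (ae_of_all _ fun ω => ?_)
    simp only [normalized, ← hs_def]
    field_simp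
  have e2 : ∫ ω, f' ((S ω - ∫ ω', S ω' ∂P) / s) / s ∂P = (∫ ω, f' (normalized P S ω) ∂P) / s :=
    integral_div _ _
  rw [e1, e2, ← hs2] at key
  rw [integral_map hW.aemeasurable hu.continuous.aestronglyMeasurable]
  have e3 : ∫ ω, u (normalized P S ω) ∂P - ∫ x, u x ∂(gaussianReal 0 1) =
      ∫ ω, f' (normalized P S ω) ∂P - ∫ ω, normalized P S ω * f (normalized P S ω) ∂P := by
    rw [← integral_sub (hf.integrable_deriv_comp hW) (hf.integrable_mul_comp hWi hW)]
    simp_rw [hstein]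
    have hui : Integrable (fun ω => u (normalized P S ω)) P := by
      refine ((hf.integrable_deriv_comp hW).sub (hf.integrable_mul_comp hWi hW)).add
        (integrable_const (∫ x, u x ∂(gaussianReal 0 1))) |>.congr (ae_of_all _ fun ω => ?_)
      simp only [Pi.add_apply, Pi.sub_apply, hstein]
      ring
    rw [integral_sub hui (integrable_const _)]
    simp
  rw [e3, abs_sub_comm]
  refine le_of_mul_le_mul_left ?_ hs
  refine (le_of_eq ?_).trans key
  rw [← abs_of_pos hs, ← abs_mul, abs_of_pos hs]
  congr 1
  field_simp

theorem corollary2p9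
    {Ω : Type*} [MeasurableSpace Ω] (P : Measure Ω) [IsProbabilityMeasure P]
    -- the index `N` and the i.i.d. summands `X 0, X 1, …`, all independent
    (N : Ω → ℕ) (X : ℕ → Ω → ℝ)
    (hN : Measurable N) (hX : ∀ j, Measurable (X j))
    (hXindep : iIndepFun X P)
    (hNX : IndepFun N (fun ω j => X j ω) P)
    (hXident : ∀ j, IdentDistrib (X j) (X 0) P P)
    (hX3 : Integrable (fun ω => |X 0 ω| ^ 3) P)
    -- `N` has the law of a sum of `n` i.i.d. nonnegative random variables `M 0, …, M (n - 1)`,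
    -- which may live on another probability space
    {Ω' : Type*} [MeasurableSpace Ω'] (Q : Measure Ω') [IsProbabilityMeasure Q]
    (n : ℕ) (hn : 0 < n) (M : Fin n → Ω' → ℝ)
    (hM : ∀ j, Measurable (M j))
    (hMindep : iIndepFun M Q)
    (hMident : ∀ j, IdentDistrib (M j) (M ⟨0, hn⟩) Q Q)
    (hM0 : ∀ j, ∀ᵐ ω ∂Q, 0 ≤ M j ω)
    (hM3 : Integrable (fun ω => M ⟨0, hn⟩ ω ^ 3) Q)
    (hNM : IdentDistrib (fun ω => (N ω : ℝ)) (fun ω => ∑ j, M j ω) P Q)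
    -- the random sum is not almost surely constant, so that it can be normalized
    (hvar : 0 < Var[randomSum N X; P])
    -- notation for the moments
    (a b c d α₁ β₁ γ₁ δ₁ σ₁ : ℝ)
    (ha : a = ∫ ω, X 0 ω ∂P)
    (hb : b = √(∫ ω, X 0 ω ^ 2 ∂P))
    (hc : c ^ 2 = Var[X 0; P])
    (hd : d ^ 3 = ∫ ω, |X 0 ω - a| ^ 3 ∂P)
    (hα₁ : α₁ = ∫ ω, M ⟨0, hn⟩ ω ∂Q)
    (hβ₁ : β₁ ^ 2 = ∫ ω, M ⟨0, hn⟩ ω ^ 2 ∂Q)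
    (hγ₁ : γ₁ ^ 2 = Var[M ⟨0, hn⟩; Q])
    (hδ₁ : δ₁ ^ 3 = ∫ ω, M ⟨0, hn⟩ ω ^ 3 ∂Q)
    (hσ₁ : σ₁ = √(c ^ 2 * α₁ + a ^ 2 * γ₁ ^ 2)) :
    wassersteinDist (P.map (normalized P (randomSum N X))) (gaussianReal 0 1) ≤
      ENNReal.ofReal (1 / √(n : ℝ) *
        (2 * c ^ 2 * b * γ₁ ^ 2 / σ₁ ^ 3 + 3 * α₁ * d ^ 3 / σ₁ ^ 3
          + √(2 / Real.pi) * (α₁ * a ^ 2 * γ₁ ^ 2 / σ₁ ^ 2)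
          + 2 * α₁ * (a ^ 2 * b + |a| * b ^ 2) / σ₁ ^ 3 * (δ₁ ^ 3 / α₁ - β₁ ^ 2))) := by
  have hX3' : MemLp (X 0) 3 P :=
    (integrable_abs_pow_three_iff (hX 0).aestronglyMeasurable).1 hX3
  have hM3' : ∀ j, MemLp (M j) 3 Q := fun j => by
    refine (hMident j).symm.memLp_snd ?_
    rw [← integrable_abs_pow_three_iff (hM _).aestronglyMeasurable]
    simpa [abs_pow] using hM3.abs
  have hM2 : ∀ j, MemLp (M j) 2 Q := fun j => (hM3' j).mono_exponent (by norm_num)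
  have hN2 : MemLp (fun ω => (N ω : ℝ)) 2 P :=
    hNM.symm.memLp_snd (memLp_finsetSum _ fun j _ => hM2 j)
  have hNmean : ∫ ω, (N ω : ℝ) ∂P = n * α₁ := by
    rw [hNM.integral_eq, integral_finsetSum _ fun j _ => (hM2 j).integrable (by norm_num)]
    simp [fun j => (hMident j).integral_eq, hα₁]
  have hNvar : Var[fun ω => (N ω : ℝ); P] = n * γ₁ ^ 2 := by
    have h := IndepFun.variance_sum (μ := Q) (X := M) (s := Finset.univ) (fun j _ => hM2 j)
      (fun i _ j _ hij => hMindep.indepFun hij)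
    simp only [fun j => (hMident j).variance_eq, Finset.sum_const, Finset.card_univ,
      Fintype.card_fin, nsmul_eq_mul] at h
    rw [hNM.variance_eq, hγ₁, ← h]
    congr 1
    ext ω; simp
  have hnat : ∀ᵐ ω ∂Q, ∃ k : ℕ, ∑ j, M j ω = (k : ℝ) := by
    refine hNM.ae_snd (p := fun x => ∃ k : ℕ, x = k) ?_ (ae_of_all _ fun ω => ⟨N ω, rfl⟩)
    convert (countable_range (fun k : ℕ => (k : ℝ))).measurableSet using 1
    ext x
    simp [eq_comm]
  obtain ⟨hS2, hSmean, hSvar⟩ := memLp_randomSum hN hX hXindep hNX hXident hX3' hN2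
  have hSm : Measurable (randomSum N X) := by
    have h : Measurable (fun z : ℕ × Ω => ∑ j ∈ Finset.range z.1, X j z.2) :=
      measurable_from_prod_countable_right fun k => measurable_partialSum hX k
    exact h.comp (hN.prodMk measurable_id)
  rw [hNmean, ← ha] at hSmean
  rw [hNmean, hNvar, ← ha, ← hc] at hSvar
  have hn0 : (0 : ℝ) < n := by exact_mod_cast hn
  have hb0 : 0 ≤ b := hb ▸ Real.sqrt_nonneg _
  have hb2 : b ^ 2 = ∫ ω, X 0 ω ^ 2 ∂P := by
    rw [hb, Real.sq_sqrt (integral_nonneg fun _ => sq_nonneg _)]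
  have hab : |a| ≤ b := by
    rw [ha, hb]
    exact (abs_integral_le_integral_abs).trans (integral_abs_le_sqrt_integral_sq
      (hX3'.mono_exponent (by norm_num)))
  have hα₁0 : 0 ≤ α₁ := hα₁ ▸ integral_nonneg_of_ae (hM0 _)
  -- Needed to divide by α₁: if α₁ = 0, the nonnegative components vanish almost surely and Var(S) =
  -- 0.
  have hα₁pos : 0 < α₁ := by
    refine lt_of_le_of_ne hα₁0 fun h0 => ?_
    have hM00 : M ⟨0, hn⟩ =ᵐ[Q] fun _ => (0 : ℝ) :=
      (integral_eq_zero_iff_of_nonneg_ae (hM0 _) ((hM2 _).integrable (by norm_num))).1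
        (hα₁ ▸ h0.symm)
    have hγ0 : γ₁ ^ 2 = 0 := by
      rw [hγ₁, variance_congr hM00]
      exact variance_zero Q
    rw [hSvar, ← h0, hγ0] at hvar
    simp at hvar
  set V := c ^ 2 * α₁ + a ^ 2 * γ₁ ^ 2 with hV
  have hSvar' : Var[randomSum N X; P] = n * V := by rw [hSvar, hV]; ring
  have hVpos : 0 < V := by
    rw [hSvar'] at hvar
    exact pos_of_mul_pos_right hvar hn0.le
  have hσpos : 0 < σ₁ := hσ₁ ▸ Real.sqrt_pos.2 hVpos
  have hσ2 : σ₁ ^ 2 = V := by rw [hσ₁, Real.sq_sqrt hVpos.le]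
  set r := √(n : ℝ) with hr
  have hrpos : 0 < r := Real.sqrt_pos.2 hn0
  have hr2 : r ^ 2 = n := Real.sq_sqrt hn0.le
  have hs : √(Var[randomSum N X; P]) = r * σ₁ := by
    rw [hSvar', Real.sqrt_mul hn0.le, hσ₁]
  set Cov := δ₁ ^ 3 - α₁ * β₁ ^ 2 with hCov
  -- Cov is Cov(M, M²) for one component M of the index, hence at least α₁ γ₁².
  have hCov0 : 0 ≤ Cov := by
    have hMa := (hM ⟨0, hn⟩).aemeasurable (μ := Q)
    have : IsProbabilityMeasure (Q.map (M ⟨0, hn⟩)) := Measure.isProbabilityMeasure_map hMa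
    have h := mean_mul_variance_le (ν := Q.map (M ⟨0, hn⟩))
      ((ae_map_iff hMa measurableSet_Ici).2 (hM0 _))
      ((integrable_map_measure (by fun_prop) hMa).2 hM3)
    rw [integral_map (f := fun m : ℝ => m) hMa (by fun_prop),
      integral_map (f := fun m : ℝ => m ^ 2) hMa (by fun_prop),
      integral_map (f := fun m : ℝ => m ^ 3) hMa (by fun_prop), ← hα₁, ← hβ₁, ← hδ₁] at h
    have hγ : γ₁ ^ 2 = β₁ ^ 2 - α₁ ^ 2 := by
      rw [hγ₁, variance_eq_sub (hM2 _), hβ₁, hα₁]; rfl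
    rw [← hγ] at h
    exact (mul_nonneg hα₁0 (sq_nonneg _)).trans h
  refine wassersteinDist_normalized_le hS2 hSm hvar fun F F' K hF => ?_
  have hL : 2 / Var[randomSum N X; P] = 2 / (r ^ 2 * σ₁ ^ 2) := by rw [hSvar', hr2, hσ2]
  rw [hL] at hF
  set L := 2 / (r ^ 2 * σ₁ ^ 2) with hLdef
  set g : ℕ → ℝ := fun k => ∫ ω', F (∑ j ∈ Finset.range k, X j ω') ∂P with hg
  set g₁ : ℕ → ℝ := fun k => ∫ ω', F' (∑ j ∈ Finset.range k, X j ω') ∂P with hg₁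
  have hidx := abs_integral_index_sum_le (g := g) (g₁ := g₁) (a := a) (K := K)
    (B := L / 2 * b ^ 2) (D := L * b) hn hM hMindep hMident hM0 hM3 hnat
    (fun k => hF.abs_integral_comp_le) (fun k => hF.abs_integral_deriv_comp_le)
    (mul_nonneg hF.lip_nonneg hb0)
    (fun k l => hb2 ▸ abs_integral_partialSum_taylor_min_le hF hX hXindep hXident hX3' ha k l)
    (fun k l => hb ▸ abs_integral_deriv_partialSum_sub_le hF hX hXident hX3' k l)
  rw [← hα₁, ← hβ₁, ← hγ₁, ← hδ₁, ← hCov] at hidx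
  -- Both sides integrate one measurable function of x, evaluated at x = N and at the sum of the
  -- components, so equality in law suffices.
  have htransfer : ∫ ω, (((N ω : ℝ) - n * α₁) * g (N ω) -
      a * Var[fun ω => (N ω : ℝ); P] * g₁ (N ω)) ∂P =
      ∫ ω, ((∑ j, M j ω - n * α₁) * g ⌊∑ j, M j ω⌋₊ - n * (a * γ₁ ^ 2) * g₁ ⌊∑ j, M j ω⌋₊) ∂Q := by
    have hm : ∀ w : ℕ → ℝ, Measurable (fun x : ℝ => w ⌊x⌋₊) := fun w =>
      (measurable_from_nat (f := w)).comp Nat.measurable_floor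
    have hw : Measurable (fun x : ℝ => (x - n * α₁) * g ⌊x⌋₊ - n * (a * γ₁ ^ 2) * g₁ ⌊x⌋₊) := by
      have := hm g
      have := hm g₁
      fun_prop
    have h := (hNM.comp hw).integral_eq
    simp only [Function.comp_def, Nat.floor_natCast] at h
    rw [hNvar, ← h]
    congr 1; ext ω; ring
  rw [← htransfer] at hidx
  have key := abs_integral_randomSum_le hF hN hX hXindep hNX hXident hX3' hN2 ha hNmean.symm hidx
  rw [← hd, ← hb, ← hc, hNvar] at key
  rw [hSmean, mul_comm _ a, hs]
  refine key.trans ?_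
  have hcovdiv : 2 * α₁ * (a ^ 2 * b + |a| * b ^ 2) / σ₁ ^ 3 * (δ₁ ^ 3 / α₁ - β₁ ^ 2) =
      2 * (a ^ 2 * b + |a| * b ^ 2) * Cov / σ₁ ^ 3 := by
    rw [hCov]; field_simp
  rw [hcovdiv, ← hr2]
  have hpi : 0 ≤ √(2 / Real.pi) * (α₁ * a ^ 2 * γ₁ ^ 2 / σ₁ ^ 2) := by positivity
  -- The argument gives 3a²b + |a|b²; one a²b is traded for |a|b² by |a| ≤ b.
  have hlast : |a| * (b ^ 2 + 3 * |a| * b) * Cov ≤ 2 * (a ^ 2 * b + |a| * b ^ 2) * Cov := by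
    refine mul_le_mul_of_nonneg_right ?_ hCov0
    have h := mul_le_mul_of_nonneg_left hab (mul_nonneg (abs_nonneg a) hb0)
    rw [← sq_abs a]
    linear_combination h
  -- Inserting L = 2 / (n σ₁²) cancels every factor n. The summand 0 holds the place of the √(2/π)
  -- term, which is nonnegative.
  calc 3 * L / 2 * (r ^ 2 * α₁) * d ^ 3 + c ^ 2 * (L * b * (r ^ 2 * γ₁ ^ 2)) +
        |a| * (r ^ 2 * ((L / 2 * b ^ 2 + 3 / 2 * (|a| * (L * b))) * Cov))
      = r * σ₁ * (1 / r * (2 * c ^ 2 * b * γ₁ ^ 2 / σ₁ ^ 3 + 3 * α₁ * d ^ 3 / σ₁ ^ 3 + 0 +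
          |a| * (b ^ 2 + 3 * |a| * b) * Cov / σ₁ ^ 3)) := by
        rw [hLdef]
        field_simp
        ring
    _ ≤ _ := by gcongr
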